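/- Conventions. Let $G$ be a (Hausdorff) locally compact group with a fixed left Haar measure $\mu$; functions are identified when they agree $\mu$-almost everywhere. $G$ is called locally elliptic if every compact subset generates a relatively compact subgroup (such a group is unimodular). A standard decomposition of $G$ is a sequence $(K_i)_{i\ge 1}$ of compact open subgroups with $K_i\le K_{i+1}$, $G=\bigcup_{i\ge 1}K_i$, and $([K_{i+1}:K_i])_{i\ge 1}$ non-decreasing. A Young function is a convex even function $\Phi:\mathbb{R}\to[0,\infty]$ with $\Phi(0)=0$ and $\lim_{x\to\infty}\Phi(x)=\infty$; its complementary function is $\Psi(y)=\sup\{x|y|-\Phi(x):x\ge 0\}$, and $(\Phi,\Psi)$ is then called a complementary pair. Put $L^\Phi(G)=\{f:G\to\mathbb{C}\text{ measurable}:\int_G\Phi(\alpha|f|)\,d\mu<\infty\text{ for some }\alpha>0\}$, with the Orlicz norm $\|f\|_{L^\Phi(G)}=\sup\{\int_G|fg|\,d\mu:\int_G\Psi(|g|)\,d\mu\le 1\}$. A weight is a measurable function $\omega:G\to[1,\infty)$ that is bounded on compact sets and satisfies $\omega(xy)\le\omega(x)\omega(y)$ and $\omega(x^{-1})=\omega(x)$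 for all $x,y\in G$; it is sub-additive if for some $C>0$, $\omega(xy)\le C(\omega(x)+\omega(y))$ for all $x,y\in G$. Let $L^\Phi(G,\omega)=\{f\in L^\Phi(G):\|f\omega\|_{L^\Phi(G)}<\infty\}$ with norm $\|f\|_{L^\Phi(G,\omega)}=\|f\omega\|_{L^\Phi(G)}$. An $L^\Phi$-weight is a weight $\omega$ for which $L^\Phi(G,\omega)$ is a Banach $*$-algebra under the convolution $(f*g)(x)=\int_G f(y)g(y^{-1}x)\,d\mu(y)$ and the involution $f^*(x)=\overline{f(x^{-1})}$, where the norm is only required to satisfy $\|f*g\|\le C\|f\|\|g\|$ for some constant $C$. For an algebra $\mathcal{A}$ over $\mathbb{C}$, $\nu_{\mathcal{A}}(f)=\sup\{|z|:z\in\sigma_{\mathcal{A}}(f)\}$ denotes the spectral radius (the spectrum is taken in the unitization if $\mathcal{A}$ has no unit). Theorem. Let $G$ be a locally elliptic group, $(K_i)_{i\ge 1}$ a standard decomposition of $G$, $(\Phi,\Psi)$ a complementary pair of Young functions, and $\omega$ an $L^\Phi$-weight on $G$ with $1/\omega\in L^\Psi(G)$. Put $a_i=\sup\{\omega(x):x\in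 K_i\}$, let $m=\mu/\mu(K_1)$, and define $$\omega_1^\sharp=(a_1+1)\chi_{K_1}+\sum_{i=2}^\infty (a_i+i^2)\,m(K_i\setminus K_{i-1})\,\chi_{K_i\setminus K_{i-1}}.$$ Then $\omega_1^\sharp$ is a sub-additive weight, $L^\Phi(G,\omega_1^\sharp)\subseteq L^\Phi(G,\omega)\subseteq L^1(G)$, and for every $f\in L^\Phi(G,\omega_1^\sharp)$, $$\nu_{L^\Phi(G,\omega)}(f)=\nu_{L^1(G)}(f).$$ -/

import Mathlib

open MeasureTheory Set Filter Topology
open scoped ENNReal NNReal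

/-- A Young function: a convex even function `ℝ → [0, ∞]` with `Φ 0 = 0` and `Φ x → ∞` as
`x → ∞`. -/
structure IsYoungFunction (Φ : ℝ → ℝ≥0∞) : Prop where
  convex : ConvexOn ℝ≥0 univ Φ
  even : ∀ x, Φ (-x) = Φ x
  map_zero : Φ 0 = 0
  tendsto_top : Tendsto Φ atTop (𝓝 ⊤)

/-- The complementary function `Ψ y = sup {x |y| - Φ x : x ≥ 0}`. The subtraction of `ℝ≥0∞`
replaces negative values by `0`; this does not change the supremum, because `x = 0` contributes
the value `0`. -/
noncomputable def youngComplement (Φ : ℝ → ℝ≥0∞) (y : ℝ) : ℝ≥0∞ :=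
  ⨆ x : ℝ≥0, (ENNReal.ofReal (x * |y|) - Φ x)

/-- `(Φ, Ψ)` is a complementary pair: `Φ` is a Young function and `Ψ` is its complementary
function. -/
structure IsComplementaryPair (Φ Ψ : ℝ → ℝ≥0∞) : Prop where
  young : IsYoungFunction Φ
  eq_complement : Ψ = youngComplement Φ

section Orlicz

variable {G : Type*} [MeasurableSpace G]

/-- Membership in the Orlicz space `L^Φ`. Functions are measurable up to null sets, and all notions
below only depend on the almost-everywhere class. -/
def MemOrlicz (μ : Measure G) (Φ : ℝ → ℝ≥0∞) (f : G → ℂ) : Prop :=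
  AEStronglyMeasurable f μ ∧ ∃ α : ℝ, 0 < α ∧ ∫⁻ x, Φ (α * ‖f x‖) ∂μ < ∞

/-- The Orlicz norm `sup {∫ |f g| : ∫ Ψ(|g|) ≤ 1}`, where `Ψ` is complementary to `Φ`. -/
noncomputable def orliczNorm (μ : Measure G) (Φ : ℝ → ℝ≥0∞) (f : G → ℂ) : ℝ≥0∞ :=
  ⨆ (g : G → ℂ) (_ : AEStronglyMeasurable g μ)
    (_ : ∫⁻ x, youngComplement Φ ‖g x‖ ∂μ ≤ 1), ∫⁻ x, ‖f x * g x‖ₑ ∂μ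

/-- The norm `‖f ω‖` of the weighted Orlicz space `L^Φ(G, ω)`. -/
noncomputable def weightedOrliczNorm (μ : Measure G) (Φ : ℝ → ℝ≥0∞) (ω : G → ℝ) (f : G → ℂ) :
    ℝ≥0∞ :=
  orliczNorm μ Φ (fun x => f x * (ω x : ℂ))

/-- The weighted Orlicz space `L^Φ(G, ω)`, as the set of its representing functions. -/
def weightedOrliczSpace (μ : Measure G) (Φ : ℝ → ℝ≥0∞) (ω : G → ℝ) : Set (G → ℂ) :=
  {f | MemOrlicz μ Φ f ∧ weightedOrliczNorm μ Φ ω f < ∞}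

/-- The space `L^1(G)`, as the set of its representing functions. -/
def lOneSpace (μ : Measure G) : Set (G → ℂ) :=
  {f | Integrable f μ}

variable [Group G]

/-- The convolution `(f * g)(x) = ∫ f(y) g(y⁻¹ x) dy`. -/
noncomputable def groupConv (μ : Measure G) (f g : G → ℂ) (x : G) : ℂ :=
  ∫ y, f y * g (y⁻¹ * x) ∂μ

/-- The involution `f^*(x) = conj (f(x⁻¹))`. -/
def groupInvol (f : G → ℂ) (x : G) : ℂ :=
  starRingEnd ℂ (f x⁻¹)

/-- The spectrum of `f` in a convolution algebra `A` of functions modulo null sets: it consists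
of `0` and of all `z ≠ 0` such that `1 - z⁻¹ f` is not invertible in the unitization of `A`, that
is, such that `z⁻¹ f` has no two-sided quasi-inverse `g` in `A` (`1 - g` being the inverse). If `A`
already has a unit, this is the usual spectrum with the point `0` adjoined, which does not affect
the spectral radius. -/
def convSpectrum (μ : Measure G) (A : Set (G → ℂ)) (f : G → ℂ) : Set ℂ :=
  {z | z = 0 ∨ ¬ ∃ g ∈ A,
    (z⁻¹ • f + g =ᵐ[μ] groupConv μ (z⁻¹ • f) g) ∧
    (z⁻¹ • f + g =ᵐ[μ] groupConv μ g (z⁻¹ • f))}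

/-- The spectral radius `sup {|z| : z ∈ σ_A(f)}`. -/
noncomputable def convSpectralRadius (μ : Measure G) (A : Set (G → ℂ)) (f : G → ℂ) : ℝ≥0∞ :=
  ⨆ z ∈ convSpectrum μ A f, ‖z‖ₑ

end Orlicz

section Weights

variable {G : Type*} [Group G] [TopologicalSpace G] [MeasurableSpace G]

/-- A weight: a measurable function `G → [1, ∞)` that is bounded on compact sets, sub-multiplicative
and symmetric. -/
structure IsWeight (ω : G → ℝ) : Prop where
  measurable : Measurable ω
  one_le : ∀ x, 1 ≤ ω x
  bddAbove : ∀ S : Set G, IsCompact S → BddAbove (ω '' S)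
  mul_le : ∀ x y, ω (x * y) ≤ ω x * ω y
  inv_eq : ∀ x, ω x⁻¹ = ω x

/-- A sub-additive weight. -/
structure IsSubadditiveWeight (ω : G → ℝ) : Prop extends IsWeight ω where
  subadd : ∃ C : ℝ, 0 < C ∧ ∀ x y, ω (x * y) ≤ C * (ω x + ω y)

/-- An `L^Φ`-weight on a unimodular group: a weight such that `L^Φ(G, ω)` is a Banach `*`-algebra
under convolution and the involution `f^*(x) = conj (f(x⁻¹))`. As usual for these spaces the product
is required to be bounded, `‖f * g‖ ≤ C ‖f‖ ‖g‖`, with some constant `C` (so that it is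
submultiplicative for an equivalent norm). The remaining axioms (completeness, bilinearity,
associativity, `(f * g)^* = g^* * f^*`) hold automatically. -/
structure IsLPhiWeight (μ : Measure G) (Φ : ℝ → ℝ≥0∞) (ω : G → ℝ) : Prop extends IsWeight ω where
  conv_exists : ∀ f ∈ weightedOrliczSpace μ Φ ω, ∀ g ∈ weightedOrliczSpace μ Φ ω,
    ∀ᵐ x ∂μ, Integrable (fun y => f y * g (y⁻¹ * x)) μ
  conv_mem : ∀ f ∈ weightedOrliczSpace μ Φ ω, ∀ g ∈ weightedOrliczSpace μ Φ ω,
    groupConv μ f g ∈ weightedOrliczSpace μ Φ ω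
  conv_norm_le : ∃ C : ℝ≥0, ∀ f ∈ weightedOrliczSpace μ Φ ω, ∀ g ∈ weightedOrliczSpace μ Φ ω,
    weightedOrliczNorm μ Φ ω (groupConv μ f g) ≤
      C * weightedOrliczNorm μ Φ ω f * weightedOrliczNorm μ Φ ω g
  invol_mem : ∀ f ∈ weightedOrliczSpace μ Φ ω, groupInvol f ∈ weightedOrliczSpace μ Φ ω
  invol_norm : ∀ f ∈ weightedOrliczSpace μ Φ ω,
    weightedOrliczNorm μ Φ ω (groupInvol f) = weightedOrliczNorm μ Φ ω f

end Weights

section LocallyElliptic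

variable (G : Type*) [Group G] [TopologicalSpace G]

/-- Every compact subset generates a relatively compact subgroup. -/
def IsLocallyElliptic : Prop :=
  ∀ S : Set G, IsCompact S → IsCompact (closure (Subgroup.closure S : Set G))

variable {G}

/-- A standard decomposition `K_1 ≤ K_2 ≤ ⋯` of `G`: an ascending sequence of compact open subgroups
with union `G` whose indices `[K_{i+1} : K_i]` are non-decreasing. The numbering is shifted: `K i`
stands for `K_{i+1}`. -/
structure IsStandardDecomposition (K : ℕ → Subgroup G) : Prop where
  isCompact : ∀ i, IsCompact (K i : Set G)
  isOpen : ∀ i, IsOpen (K i : Set G)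
  le_succ : ∀ i, K i ≤ K (i + 1)
  iUnion_eq : ⋃ i, (K i : Set G) = univ
  index_mono : Monotone fun i => (K i).relIndex (K (i + 1))

/-- The function `ω♯₁ = (a_1 + 1) χ_{K_1} + ∑_{i ≥ 2} (a_i + i²) m(K_i \ K_{i-1}) χ_{K_i \ K_{i-1}}`,
where `a_i = sup {ω x : x ∈ K_i}` and `m = μ / μ(K_1)` is the Haar measure normalised by
`m(K_1) = 1`. Here `K i` stands for `K_{i+1}`, and at each point at most one term of the sum is
nonzero. -/
noncomputable def sharpOne [MeasurableSpace G] (μ : Measure G) (K : ℕ → Subgroup G) (ω : G → ℝ)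
    (x : G) : ℝ :=
  (K 0 : Set G).indicator (fun _ => sSup (ω '' (K 0 : Set G)) + 1) x +
    ∑' i : ℕ, ((K (i + 1) : Set G) \ (K i : Set G)).indicator
      (fun _ => (sSup (ω '' (K (i + 1) : Set G)) + ((i : ℝ) + 2) ^ 2) *
        (μ.real ((K (i + 1) : Set G) \ (K i : Set G)) / μ.real (K 0 : Set G))) x

end LocallyElliptic

/-! Write `v` for `sharpOne μ K ω`. Hölder's inequality applied to `f = (f ω)(1/ω)` puts the
`ω`-space inside `L¹`, and `ω ≤ v` puts the `v`-space inside the `ω`-space. A quasi-inverse in a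
smaller space is one in a larger space, so the spectral radius in `L¹` is at most the one in the
`ω`-space. The content is the reverse inequality.

The value of `v` at a point depends only on the first subgroup of the chain containing it, and grows
with that position. Hence `v (x * y) ≤ max (v x) (v y)`, and in particular `v (x * y) ≤ v x + v y`.
Since Orlicz norms are translation invariant, this makes the `v`-norm a differential norm over `L¹`:
`‖f * g‖_v ≤ ‖f‖_v ‖g‖₁ + ‖f‖₁ ‖g‖_v` (`weightedOrliczNorm_groupConv_le`).

Let `|z|` exceed the `L¹` spectral radius of `f` and put `h = z⁻¹ f`. Convolution by `h` on `L¹` has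
spectral radius below 1 (`spectralRadius_l1Conv_le`), so by Gelfand's formula the convolution powers
of `h` tend to 0 in `L¹`. For every `ε`, `‖·‖₁ + ε ‖·‖_v` is submultiplicative; for small `ε` it is
below 1 on some power of `h`, so the Neumann series converges absolutely in both norms
(`tsum_pow_ne_top`). Minus its sum is a quasi-inverse with finite `v`-norm, hence in the `ω`-space,
and `z` is not in the spectrum there.

The group need not be second countable, so joint measurability in convolution integrals is obtained
through Baire representatives. -/

section Orlicz

variable {G : Type*} [MeasurableSpace G] {μ : Measure G} {Φ Ψ : ℝ → ℝ≥0∞}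

/-! ### Young functions, complementary functions and the Orlicz norm. -/

namespace IsYoungFunction

/-- A Young function is star-shaped: the chord from the origin lies above the graph. -/
theorem map_mul_le (hΦ : IsYoungFunction Φ) {t : ℝ≥0} (ht : t ≤ 1) (x : ℝ) :
    Φ (t * x) ≤ t * Φ x := by
  have h := hΦ.convex.2 (mem_univ x) (mem_univ (0 : ℝ)) zero_le zero_le
    (add_tsub_cancel_of_le ht)
  simpa [hΦ.map_zero, NNReal.smul_def, ENNReal.smul_def] using h

theorem mul_map_le (hΦ : IsYoungFunction Φ) {s : ℝ≥0} (hs : 1 ≤ s) (x : ℝ) :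
    s * Φ x ≤ Φ (s * x) := by
  have hs0 : s ≠ 0 := (zero_lt_one.trans_le hs).ne'
  have h := hΦ.map_mul_le (t := s⁻¹) (inv_le_one_of_one_le₀ hs) (s * x)
  have h2 : ((s⁻¹ : ℝ≥0) : ℝ) * (s * x) = x := by
    rw [← mul_assoc, ← NNReal.coe_mul, inv_mul_cancel₀ hs0]; simp
  rw [h2] at h
  calc (s : ℝ≥0∞) * Φ x ≤ s * ((s⁻¹ : ℝ≥0) * Φ (s * x)) := by gcongr
    _ = Φ (s * x) := by
      rw [← mul_assoc, ← ENNReal.coe_mul, mul_inv_cancel₀ hs0]; simp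

theorem monotoneOn (hΦ : IsYoungFunction Φ) : MonotoneOn Φ (Ici 0) := by
  intro x hx y hy hxy
  lift x to ℝ≥0 using hx
  lift y to ℝ≥0 using hy
  have hxy' : x ≤ y := by exact_mod_cast hxy
  rcases eq_or_ne x 0 with rfl | hx0
  · simp [hΦ.map_zero]
  have h1 : 1 ≤ y / x := by rwa [one_le_div (pos_iff_ne_zero.2 hx0)]
  have h := hΦ.mul_map_le h1 x
  rw [← NNReal.coe_mul, div_mul_cancel₀ _ hx0] at h
  exact (le_mul_of_one_le_left zero_le (by exact_mod_cast h1)).trans h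

theorem measurable (hΦ : IsYoungFunction Φ) : Measurable Φ := by
  have hmono : Monotone fun x : ℝ => Φ (max x 0) := fun x y h =>
    hΦ.monotoneOn (mem_Ici.2 (le_max_right _ _)) (mem_Ici.2 (le_max_right _ _))
      (max_le_max_right _ h)
  have h : Φ = fun x : ℝ => (fun x : ℝ => Φ (max x 0)) |x| := by
    funext x
    rcases le_total 0 x with hx | hx
    · simp [abs_of_nonneg hx, hx]
    · simp [abs_of_nonpos hx, hx, hΦ.even]
  rw [h]
  exact hmono.measurable.comp measurable_norm

end IsYoungFunction

theorem youngComplement_zero (Φ : ℝ → ℝ≥0∞) : youngComplement Φ 0 = 0 := by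
  simp [youngComplement]

/-- This scaling bound lets any function with finite complementary modular be shrunk to an
admissible test function. -/
theorem youngComplement_mul_le (Φ : ℝ → ℝ≥0∞) {t : ℝ≥0} (ht : t ≤ 1) (y : ℝ) :
    youngComplement Φ (t * y) ≤ t * youngComplement Φ y := by
  refine iSup_le fun x => ?_
  have h1 : ENNReal.ofReal (x * |(t : ℝ) * y|) = t * ENNReal.ofReal (x * |y|) := by
    rw [abs_mul, NNReal.abs_eq, mul_left_comm, ENNReal.ofReal_mul t.coe_nonneg,
      ENNReal.ofReal_coe_nnreal]
  have ht' : (t : ℝ≥0∞) ≤ 1 := by exact_mod_cast ht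
  calc ENNReal.ofReal (x * |(t : ℝ) * y|) - Φ x
      ≤ t * ENNReal.ofReal (x * |y|) - t * Φ x := by
        rw [h1]; gcongr; exact mul_le_of_le_one_left zero_le ht'
    _ = t * (ENNReal.ofReal (x * |y|) - Φ x) :=
        (ENNReal.mul_sub fun _ _ => ENNReal.coe_ne_top).symm
    _ ≤ t * youngComplement Φ y := by
        gcongr
        exact le_iSup (fun x : ℝ≥0 => ENNReal.ofReal (x * |y|) - Φ x) x

/-- Below the slope `Φ u / u` of a chord, the complementary function is at most `u y`. -/
theorem IsYoungFunction.youngComplement_le (hΦ : IsYoungFunction Φ) {u y : ℝ≥0}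
    (hu : u ≠ 0) (h : (u * y : ℝ≥0∞) ≤ Φ u) : youngComplement Φ y ≤ u * y := by
  refine iSup_le fun x => ?_
  have h1 : ENNReal.ofReal (x * |(y : ℝ)|) = x * y := by
    rw [NNReal.abs_eq, ENNReal.ofReal_mul x.coe_nonneg]; simp
  rw [h1]
  rcases le_total x u with hx | hx
  · exact tsub_le_self.trans (by gcongr)
  have h2 := hΦ.mul_map_le (s := x / u) (by rwa [one_le_div (pos_iff_ne_zero.2 hu)]) u
  have h3 : ((x / u : ℝ≥0) : ℝ) * u = x := by
    rw [← NNReal.coe_mul, div_mul_cancel₀ _ hu]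
  rw [h3] at h2
  have h4 : (x * y : ℝ≥0∞) ≤ Φ x := calc
    (x * y : ℝ≥0∞) = ((x / u : ℝ≥0) : ℝ≥0∞) * (u * y) := by
      rw [← mul_assoc, ← ENNReal.coe_mul (x / u) u, div_mul_cancel₀ _ hu]
    _ ≤ _ := by gcongr
    _ ≤ Φ x := h2
  rw [tsub_eq_zero_of_le h4]; exact zero_le

theorem lintegral_le_orliczNorm {f g : G → ℂ} (hg : AEStronglyMeasurable g μ)
    (h : ∫⁻ x, youngComplement Φ ‖g x‖ ∂μ ≤ 1) :
    ∫⁻ x, ‖f x * g x‖ₑ ∂μ ≤ orliczNorm μ Φ f :=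
  le_iSup_of_le g (le_iSup_of_le hg (le_iSup_of_le h le_rfl))

theorem orliczNorm_mono {f g : G → ℂ} (h : ∀ᵐ x ∂μ, ‖f x‖ₑ ≤ ‖g x‖ₑ) :
    orliczNorm μ Φ f ≤ orliczNorm μ Φ g := by
  refine iSup_mono fun u => iSup_mono fun _ => iSup_mono fun _ => lintegral_mono_ae ?_
  filter_upwards [h] with x hx
  simp only [enorm_mul]
  gcongr

/-- With `u = a |f|`, the chord slope `γ = Φ(u)/u` satisfies `Ψ(γ) ≤ u γ = Φ(u)`. If `∫ u γ`
exceeded 1, dividing `γ` by this integral would give an admissible test function whose pairing with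
`u` is exactly 1, against `a ‖f‖ < 1`. Truncation keeps the integral finite. -/
theorem IsYoungFunction.lintegral_le_one (hΦ : IsYoungFunction Φ) [SigmaFinite μ]
    {f : G → ℂ} (hf : Measurable f) {a : ℝ≥0} (ha : a * orliczNorm μ Φ f < 1) :
    ∫⁻ x, Φ (a * ‖f x‖) ∂μ ≤ 1 := by
  set u : G → ℝ≥0 := fun x => a * ‖f x‖₊ with hu
  have hum : Measurable u := hf.nnnorm.const_mul a
  have hΦum : Measurable fun x => Φ (u x) := hΦ.measurable.comp hum.coe_nnreal_real
  -- On `S n` both the measure and `u` are bounded; capping the slope at `n` then makes `∫ u γ`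
  -- finite.
  set S : ℕ → Set G := fun n => spanningSets μ n ∩ {x | u x ≤ n} with hS
  have hSm : ∀ n, MeasurableSet (S n) := fun n =>
    (measurableSet_spanningSets μ n).inter (hum measurableSet_Iic)
  set γ : ℕ → G → ℝ≥0 := fun n =>
    (S n).indicator fun x => (min (Φ (u x) / u x) (n : ℝ≥0∞)).toNNReal with hγ
  have hγm : ∀ n, Measurable (γ n) := fun n =>
    ((hΦum.div hum.coe_nnreal_ennreal).min measurable_const).ennreal_toNNReal.indicator (hSm n)
  have hmin : ∀ (n : ℕ) x, min (Φ (u x) / u x) (n : ℝ≥0∞) ≠ ∞ := fun n x =>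
    ((min_le_right _ _).trans_lt (ENNReal.natCast_lt_top n)).ne
  have hγΨ : ∀ n x, youngComplement Φ (γ n x) ≤ u x * γ n x := by
    intro n x
    by_cases hx : x ∈ S n ∧ u x ≠ 0
    · refine hΦ.youngComplement_le hx.2 ?_
      simp only [hγ, indicator_of_mem hx.1, ENNReal.coe_toNNReal (hmin n x)]
      exact (mul_le_mul_right (min_le_left _ _) _).trans ENNReal.mul_div_le
    · have h0 : γ n x = 0 := by
        by_cases h : x ∈ S n
        · have h' : u x = 0 := by tauto
          simp [hγ, h', hΦ.map_zero]
        · simp [hγ, h]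
      simp [h0, youngComplement_zero]
  have hJ : ∀ n, ∫⁻ x, u x * γ n x ∂μ ≤ 1 := by
    intro n
    set J := ∫⁻ x, u x * γ n x ∂μ with hJdef
    have hJfin : J ≠ ∞ := by
      refine ne_top_of_le_ne_top (b := ((n : ℝ≥0∞) * n) * μ (S n)) ?_ ?_
      · refine ENNReal.mul_ne_top (by finiteness) ?_
        exact ((measure_mono inter_subset_left).trans_lt (measure_spanningSets_lt_top μ n)).ne
      · rw [← lintegral_indicator_const (hSm n)]
        refine lintegral_mono fun x => ?_
        by_cases hx : x ∈ S n
        · simp only [hγ, indicator_of_mem hx, ENNReal.coe_toNNReal (hmin n x)]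
          have : u x ≤ n := hx.2
          gcongr
          · exact_mod_cast this
          · exact min_le_right _ _
        · simp [hγ, hx]
    by_contra! hJ1
    set s : ℝ≥0 := J.toNNReal⁻¹ with hs
    have hJs : (s : ℝ≥0∞) * J = 1 := by
      rw [hs, ENNReal.coe_inv, ENNReal.coe_toNNReal hJfin]
      · exact ENNReal.inv_mul_cancel (zero_lt_one.trans hJ1).ne' hJfin
      · exact ENNReal.toNNReal_ne_zero.2 ⟨(zero_lt_one.trans hJ1).ne', hJfin⟩
    have hs1 : s ≤ 1 := by
      refine inv_le_one_of_one_le₀ ?_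
      rw [← ENNReal.coe_le_coe, ENNReal.coe_toNNReal hJfin]
      exact hJ1.le
    have htest := lintegral_le_orliczNorm (f := f) (μ := μ) (Φ := Φ)
      (g := fun x => ((s * γ n x : ℝ) : ℂ))
      (by
        refine Measurable.aestronglyMeasurable ?_
        exact Complex.measurable_ofReal.comp ((hγm n).coe_nnreal_real.const_mul _))
      (by
        calc ∫⁻ x, youngComplement Φ ‖((s * γ n x : ℝ) : ℂ)‖ ∂μ
            ≤ ∫⁻ x, s * (u x * γ n x) ∂μ := by
              refine lintegral_mono fun x => ?_
              rw [Complex.norm_real, Real.norm_of_nonneg (by positivity)]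
              exact (youngComplement_mul_le Φ hs1 _).trans (mul_le_mul_right (hγΨ n x) _)
          _ = 1 := by rw [lintegral_const_mul' _ _ ENNReal.coe_ne_top, hJs]
          _ ≤ 1 := le_rfl)
    have : (1 : ℝ≥0∞) ≤ a * orliczNorm μ Φ f := by
      calc (1 : ℝ≥0∞) = s * J := hJs.symm
        _ = a * ∫⁻ x, ‖f x * ((s * γ n x : ℝ) : ℂ)‖ₑ ∂μ := by
          rw [hJdef, ← lintegral_const_mul' _ _ ENNReal.coe_ne_top,
            ← lintegral_const_mul' _ _ ENNReal.coe_ne_top]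
          refine lintegral_congr fun x => ?_
          have : ‖((s * γ n x : ℝ) : ℂ)‖ₑ = s * γ n x := by
            rw [← NNReal.coe_mul, enorm_eq_nnnorm, ← ENNReal.coe_mul]
            simp
          rw [enorm_mul, this, hu, ENNReal.coe_mul, ← enorm_eq_nnnorm]
          ring
        _ ≤ _ := by gcongr
    exact absurd ha this.not_gt
  have hlim : ∀ x, Tendsto (fun n => (u x * γ n x : ℝ≥0∞)) atTop (𝓝 (Φ (a * ‖f x‖))) := by
    intro x
    have hux : (a * ‖f x‖ : ℝ) = u x := by simp [hu]
    rw [hux]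
    rcases eq_or_ne (u x) 0 with h0 | h0
    · simp [h0, hΦ.map_zero]
    have h1 : Tendsto (fun n : ℕ => (u x : ℝ≥0∞) * min (Φ (u x) / u x) (n : ℝ≥0∞)) atTop
        (𝓝 (u x * min (Φ (u x) / u x) ∞)) :=
      ENNReal.Tendsto.const_mul (tendsto_const_nhds.min ENNReal.tendsto_nat_nhds_top)
        (Or.inr ENNReal.coe_ne_top)
    rw [min_top_right, ENNReal.mul_div_cancel (by simpa using h0) ENNReal.coe_ne_top] at h1
    refine h1.congr' ?_
    obtain ⟨N, hN⟩ := exists_nat_ge (u x)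
    have hspan : x ∈ ⋃ n, spanningSets μ n := by simp [iUnion_spanningSets]
    obtain ⟨M, hM⟩ := mem_iUnion.1 hspan
    filter_upwards [eventually_ge_atTop N, eventually_ge_atTop M] with n hn hm
    have hx : x ∈ S n :=
      ⟨monotone_spanningSets μ hm hM, hN.trans (by exact_mod_cast hn)⟩
    simp only [hγ, indicator_of_mem hx, ENNReal.coe_toNNReal (hmin n x)]
  -- Fatou's lemma removes the truncation.
  calc ∫⁻ x, Φ (a * ‖f x‖) ∂μ
      = ∫⁻ x, liminf (fun n => (u x * γ n x : ℝ≥0∞)) atTop ∂μ :=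
        lintegral_congr fun x => (hlim x).liminf_eq.symm
    _ ≤ liminf (fun n => ∫⁻ x, u x * γ n x ∂μ) atTop :=
        lintegral_liminf_le fun n => hum.coe_nnreal_ennreal.mul (hγm n).coe_nnreal_ennreal
    _ ≤ 1 := by
        refine liminf_le_of_le (by isBoundedDefault) fun b hb => ?_
        obtain ⟨n, hn⟩ := hb.exists
        exact hn.trans (hJ n)

/-- A function of finite Orlicz norm belongs to the Orlicz space. -/
theorem IsYoungFunction.memOrlicz_of_orliczNorm_lt_top [SigmaFinite μ] (hΦ : IsYoungFunction Φ)
    {f : G → ℂ} (hf : AEStronglyMeasurable f μ) (hfin : orliczNorm μ Φ f < ∞) :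
    MemOrlicz μ Φ f := by
  have hae := hf.ae_eq_mk
  set f' := hf.mk f
  have hle : orliczNorm μ Φ f' ≤ orliczNorm μ Φ f :=
    orliczNorm_mono (hae.mono fun x hx => by rw [hx])
  set c := (orliczNorm μ Φ f).toNNReal with hc
  have hcc : orliczNorm μ Φ f = c := (ENNReal.coe_toNNReal hfin.ne).symm
  have hpos : 0 < (c + 1)⁻¹ := by positivity
  have h1 := hΦ.lintegral_le_one (μ := μ) (f := f') hf.stronglyMeasurable_mk.measurable
    (a := (c + 1)⁻¹) (by
      refine (mul_le_mul_right hle _).trans_lt ?_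
      rw [hcc, ← ENNReal.coe_mul, ENNReal.coe_lt_one_iff, inv_mul_lt_iff₀ (by positivity)]
      simp)
  refine ⟨hf, ((c + 1)⁻¹ : ℝ≥0), by exact_mod_cast hpos, ?_⟩
  exact (lintegral_mono_ae (hae.mono fun x hx => by rw [hx])).trans_lt
    (h1.trans_lt ENNReal.one_lt_top)

/-- Hölder's inequality, qualitatively: the product of `f` with an element of the complementary
Orlicz space is integrable if `f` has finite Orlicz norm. -/
theorem lintegral_mul_lt_top_of_memOrlicz {f g : G → ℂ}
    (hfin : orliczNorm μ Φ f < ∞) (hg : MemOrlicz μ (youngComplement Φ) g) :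
    ∫⁻ x, ‖f x * g x‖ₑ ∂μ < ∞ := by
  obtain ⟨hgm, α, hα, hI⟩ := hg
  set I := ∫⁻ x, youngComplement Φ (α * ‖g x‖) ∂μ with hIdef
  -- The maximum with 1 ensures both `t ≤ 1`, needed for the scaling bound, and `t * I ≤ 1`.
  set t : ℝ≥0 := (max 1 I.toNNReal)⁻¹ with ht
  have hm : 1 ≤ max 1 I.toNNReal := le_max_left _ _
  have ht1 : t ≤ 1 := inv_le_one_of_one_le₀ hm
  have ht0 : 0 < t := inv_pos.2 (zero_lt_one.trans_le hm)
  have hle : ∫⁻ x, youngComplement Φ ‖((t * α : ℝ) : ℂ) * g x‖ ∂μ ≤ 1 := by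
    calc ∫⁻ x, youngComplement Φ ‖((t * α : ℝ) : ℂ) * g x‖ ∂μ
        ≤ ∫⁻ x, t * youngComplement Φ (α * ‖g x‖) ∂μ := by
          refine lintegral_mono fun x => ?_
          rw [norm_mul, Complex.norm_real, Real.norm_of_nonneg (by positivity), mul_assoc]
          exact youngComplement_mul_le Φ ht1 _
      _ = t * I := lintegral_const_mul' _ _ ENNReal.coe_ne_top
      _ ≤ 1 := by
          rw [← ENNReal.coe_toNNReal hI.ne, ← ENNReal.coe_mul, ENNReal.coe_le_one_iff, ht,
            inv_mul_le_iff₀ (zero_lt_one.trans_le hm), mul_one]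
          exact le_max_right _ _
  have h := (lintegral_le_orliczNorm (f := f) (hgm.const_mul ((t * α : ℝ) : ℂ)) hle).trans_lt hfin
  have h2 : ∫⁻ x, ‖f x * (((t * α : ℝ) : ℂ) * g x)‖ₑ ∂μ
      = ‖((t * α : ℝ) : ℂ)‖ₑ * ∫⁻ x, ‖f x * g x‖ₑ ∂μ := by
    rw [← lintegral_const_mul' _ _ enorm_ne_top]
    refine lintegral_congr fun x => ?_
    simp only [enorm_mul]; ring
  rw [h2] at h
  have h0 : ‖((t * α : ℝ) : ℂ)‖ₑ ≠ 0 := by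
    rw [enorm_ne_zero, Complex.ofReal_ne_zero]; positivity
  exact ENNReal.lt_top_of_mul_ne_top_right h.ne h0

end Orlicz

/-! ### Baire representatives and joint measurability. -/

section Baire

/-- The Baire `σ`-algebra, generated by the continuous real functions. -/
@[reducible]
def baireSpace (G : Type*) [TopologicalSpace G] : MeasurableSpace G :=
  ⨆ φ : C(G, ℝ), (borel ℝ).comap φ

theorem measurableSet_baireSpace_preimage {G : Type*} [TopologicalSpace G] (φ : C(G, ℝ))
    {s : Set ℝ} (hs : MeasurableSet s) : MeasurableSet[baireSpace G] (φ ⁻¹' s) :=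
  (le_iSup (fun φ : C(G, ℝ) => (borel ℝ).comap φ) φ) _ ⟨s, hs, rfl⟩

theorem measurable_baireSpace_iff {X G : Type*} [MeasurableSpace X] [TopologicalSpace G]
    {f : X → G} :
    Measurable[_, baireSpace G] f ↔ ∀ φ : C(G, ℝ), Measurable fun x => φ (f x) := by
  rw [measurable_iff_comap_le, baireSpace, MeasurableSpace.comap_iSup, iSup_le_iff]
  refine forall_congr' fun φ => ?_
  rw [MeasurableSpace.comap_comp, ← BorelSpace.measurable_eq (α := ℝ), ← measurable_iff_comap_le]
  rfl

/-- A function of two variables that is jointly continuous is measurable for the product of the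
Borel `σ`-algebras, on `σ`-compact locally compact spaces without any countability assumption. -/
theorem measurable_uncurry_of_continuous {X Y : Type*} [TopologicalSpace X] [TopologicalSpace Y]
    [SigmaCompactSpace X] [SigmaCompactSpace Y] [LocallyCompactSpace Y]
    [MeasurableSpace X] [MeasurableSpace Y] [BorelSpace X] [BorelSpace Y]
    (φ : C(X × Y, ℝ)) : Measurable φ := by
  let _ : MeasurableSpace C(Y, ℝ) := borel _
  have : BorelSpace C(Y, ℝ) := ⟨rfl⟩
  -- The curried map has σ-compact image in the metrizable space `C(Y, ℝ)`, hence separable range.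
  -- It is thus a limit of simple functions, and each of these gives a countable union of measurable
  -- rectangles.
  have hsep : TopologicalSpace.IsSeparable (range φ.curry) := by
    rw [← image_univ]
    let _ := TopologicalSpace.pseudoMetrizableSpacePseudoMetric C(Y, ℝ)
    have : IsSigmaCompact (φ.curry '' univ) := isSigmaCompact_univ.image φ.curry.continuous
    obtain ⟨Kc, hKc, hU⟩ := this
    rw [← hU]
    exact TopologicalSpace.IsSeparable.iUnion fun n => (hKc n).isSeparable
  have hsm : StronglyMeasurable φ.curry :=
    stronglyMeasurable_iff_measurable_separable.2 ⟨φ.curry.continuous.measurable, hsep⟩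
  obtain ⟨s, hs⟩ := hsm
  have hlim : ∀ p : X × Y, Tendsto (fun n => s n p.1 p.2) atTop (𝓝 (φ p)) := fun p =>
    ((ContinuousEvalConst.continuous_eval_const p.2).tendsto _).comp (hs p.1)
  refine measurable_of_tendsto_metrizable (f := fun n (p : X × Y) => s n p.1 p.2) (fun n => ?_)
    (tendsto_pi_nhds.2 hlim)
  intro t ht
  have : (fun p : X × Y => s n p.1 p.2) ⁻¹' t =
      ⋃ ψ ∈ (s n).range, (s n ⁻¹' {ψ}) ×ˢ (ψ ⁻¹' t) := by
    ext p
    simp only [mem_preimage, mem_iUnion, SimpleFunc.mem_range, mem_prod, mem_singleton_iff,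
      exists_prop]
    exact ⟨fun h => ⟨_, mem_range_self p.1, rfl, h⟩, by rintro ⟨_, -, rfl, h⟩; exact h⟩
  rw [this]
  exact Finset.measurableSet_biUnion _ fun ψ _ =>
    ((s n).measurableSet_fiber ψ).prod (ψ.continuous.measurable ht)

/-- Multiplication need not be measurable from the product of Borel σ-algebras to the Borel
σ-algebra; restricting the target to Baire sets avoids this. -/
theorem measurable_mul_baireSpace {G : Type*} [Group G] [TopologicalSpace G] [IsTopologicalGroup G]
    [LocallyCompactSpace G] [SigmaCompactSpace G] [MeasurableSpace G] [BorelSpace G] :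
    Measurable[_, baireSpace G] fun p : G × G => p.1 * p.2 :=
  measurable_baireSpace_iff.2 fun φ =>
    measurable_uncurry_of_continuous (φ.comp ⟨fun p : G × G => p.1 * p.2, continuous_mul⟩)

/-- For a regular `σ`-finite measure, every measurable set is almost everywhere equal to a Baire
set. -/
theorem exists_baire_ae_eq {G : Type*} [TopologicalSpace G] [T2Space G] [LocallyCompactSpace G]
    [MeasurableSpace G] [BorelSpace G] [SigmaCompactSpace G] {μ : Measure G} [μ.Regular]
    {s : Set G} (hs : MeasurableSet s) :
    ∃ t, MeasurableSet[baireSpace G] t ∧ s =ᵐ[μ] t := by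
  induction s, hs using MeasurableSet.induction_on_open with
  | compl s hs ih =>
    obtain ⟨t, ht, hst⟩ := ih
    exact ⟨tᶜ, ht.compl, hst.compl⟩
  | iUnion f _ _ ih =>
    choose t ht hst using ih
    exact ⟨⋃ n, t n, MeasurableSet.iUnion ht, Filter.EventuallyEq.countable_iUnion hst⟩
  | isOpen U hU =>
    -- Each finite-measure piece of `U` is exhausted up to `1/(k+1)` by compact sets, and Urysohn
    -- functions vanishing off `U` enlarge these to Baire subsets of `U`.
    set A : ℕ → Set G := fun n => U ∩ spanningSets μ n with hA
    have hAm : ∀ n, MeasurableSet (A n) := fun n =>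
      hU.measurableSet.inter (measurableSet_spanningSets μ n)
    have hAfin : ∀ n, μ (A n) ≠ ∞ := fun n =>
      ((measure_mono inter_subset_right).trans_lt (measure_spanningSets_lt_top μ n)).ne
    have hε : ∀ k : ℕ, ((k : ℝ≥0∞) + 1)⁻¹ ≠ 0 := fun k => by simp
    choose C hCA hC hCμ using fun n k => (hAm n).exists_isCompact_sdiff_lt (hAfin n) (hε k)
    choose φ hφ0 hφ1 hφ using fun n k => exists_continuous_zero_one_of_isCompact' (hC n k)
      hU.isClosed_compl (disjoint_compl_right_iff_subset.2 ((hCA n k).trans inter_subset_left))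
    set t : Set G := ⋃ n, ⋃ k, φ n k ⁻¹' {1} with ht
    have htU : t ⊆ U := by
      refine iUnion_subset fun n => iUnion_subset fun k x hx => ?_
      by_contra hxU
      have h0 : φ n k x = 0 := hφ0 n k hxU
      have h1 : φ n k x = 1 := hx
      simp [h0] at h1
    refine ⟨t, MeasurableSet.iUnion fun n => MeasurableSet.iUnion fun k =>
      measurableSet_baireSpace_preimage _ (measurableSet_singleton 1), ?_⟩
    refine (ae_le_set.2 ?_).antisymm htU.eventuallyLE
    have hsub : U \ t ⊆ ⋃ n, A n \ t := by
      intro x hx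
      have : x ∈ ⋃ n, spanningSets μ n := by simp [iUnion_spanningSets]
      obtain ⟨n, hn⟩ := mem_iUnion.1 this
      exact mem_iUnion.2 ⟨n, ⟨hx.1, hn⟩, hx.2⟩
    refine measure_mono_null hsub (measure_iUnion_null fun n => ?_)
    have hle : ∀ k : ℕ, μ (A n \ t) ≤ ((k : ℝ≥0∞) + 1)⁻¹ := fun k =>
      (measure_mono (sdiff_subset_sdiff_right fun x hx =>
        mem_iUnion.2 ⟨n, mem_iUnion.2 ⟨k, hφ1 n k hx⟩⟩)).trans (hCμ n k).le
    have hlim : Tendsto (fun k : ℕ => ((k : ℝ≥0∞) + 1)⁻¹) atTop (𝓝 0) := by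
      have h := (tendsto_add_atTop_iff_nat 1).2 ENNReal.tendsto_inv_nat_nhds_zero
      simpa using h
    exact le_antisymm (ge_of_tendsto' hlim hle) zero_le

variable {G : Type*} [TopologicalSpace G] [T2Space G] [LocallyCompactSpace G]
    [MeasurableSpace G] [BorelSpace G] [SigmaCompactSpace G] {μ : Measure G} [μ.Regular]

/-- For a regular `σ`-finite measure, every measurable function is almost everywhere equal to a
Baire function. -/
theorem aestronglyMeasurable_baireSpace {E : Type*} [TopologicalSpace E] [AddMonoid E]
    [ContinuousAdd E] [TopologicalSpace.IsCompletelyMetrizableSpace E] {f : G → E} (hf : AEStronglyMeasurable f μ) : AEStronglyMeasurable[baireSpace G] f μ := by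
  classical
  have hsimple : ∀ s : SimpleFunc G E, AEStronglyMeasurable[baireSpace G] s μ := by
    intro s
    induction s using SimpleFunc.induction with
    | const c hs =>
      obtain ⟨t, ht, hst⟩ := exists_baire_ae_eq (μ := μ) hs
      refine ⟨t.indicator fun _ => c, stronglyMeasurable_const.indicator ht, ?_⟩
      rw [SimpleFunc.coe_piecewise, SimpleFunc.coe_const, SimpleFunc.coe_const, Function.const_zero,
        piecewise_eq_indicator]
      exact indicator_ae_eq_of_ae_eq_set hst
    | add _ hf hg => exact hf.add hg
  have hlim : ∀ (m : MeasurableSpace G) (s : ℕ → G → E), (∀ n, StronglyMeasurable[m] (s n)) →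
      StronglyMeasurable[m] fun x => limUnder atTop fun n => s n x :=
    fun m s hs => StronglyMeasurable.limUnder hs
  obtain ⟨g, ⟨s, hs⟩, hfg⟩ := hf
  choose s' hs' hss' using fun n => hsimple (s n)
  -- The Baire versions of the simple approximants converge only almost everywhere; `limUnder` is
  -- defined everywhere and stays strongly measurable.
  refine ⟨fun x => limUnder atTop (fun n => s' n x), hlim _ s' hs', ?_⟩
  filter_upwards [hfg, ae_all_iff.2 hss'] with x hx hn
  rw [hx]
  exact (Tendsto.limUnder_eq ((hs x).congr hn)).symm

theorem aemeasurable_baireSpace {f : G → ℝ≥0∞} (hf : AEMeasurable f μ) :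
    ∃ g, Measurable[baireSpace G] g ∧ f =ᵐ[μ] g := by
  obtain ⟨g, hg, hfg⟩ := aestronglyMeasurable_baireSpace hf.aestronglyMeasurable
  exact ⟨g, hg.measurable, hfg⟩

end Baire

/-! ### Unimodularity from compact open subgroups. -/

section Unimodular

variable {G : Type*} [Group G] [TopologicalSpace G] [IsTopologicalGroup G] [LocallyCompactSpace G]
  [MeasurableSpace G] [BorelSpace G] {μ : Measure G} [μ.IsHaarMeasure] [μ.Regular]

/-- A regular left-invariant measure agreeing with a Haar measure on some compact open subgroup is
equal to it. -/
theorem eq_of_apply_eq_compactOpen {ν : Measure G} [ν.IsMulLeftInvariant] [ν.Regular]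
    {K : Subgroup G} (hK : IsCompact (K : Set G)) (hKo : IsOpen (K : Set G))
    (h : ν K = μ K) : ν = μ := by
  have hν := Measure.isMulLeftInvariant_eq_smul_of_regular ν μ
  have h0 : μ K ≠ 0 := (hKo.measure_pos μ ⟨1, K.one_mem⟩).ne'
  have h1 : ((ν.haarScalarFactor μ : ℝ≥0) : ℝ≥0∞) = 1 := by
    rw [hν, Measure.smul_apply, ENNReal.smul_def, smul_eq_mul] at h
    exact (ENNReal.mul_left_inj h0 hK.measure_lt_top.ne).1 (by rw [h, one_mul])
  rw [ENNReal.coe_eq_one] at h1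
  rw [hν, h1, one_smul]

/-- A Haar measure is right-invariant as soon as every element lies in a compact open subgroup. -/
theorem isMulRightInvariant_of_compactOpen
    (h : ∀ x : G, ∃ K : Subgroup G, IsCompact (K : Set G) ∧ IsOpen (K : Set G) ∧ x ∈ K) :
    μ.IsMulRightInvariant := by
  refine ⟨fun g => ?_⟩
  obtain ⟨K, hK, hKo, hg⟩ := h g
  have : (μ.map (· * g)).Regular := Measure.Regular.map (Homeomorph.mulRight g)
  -- Right translation by `g` maps `K` onto itself because `g ∈ K`.
  refine eq_of_apply_eq_compactOpen hK hKo ?_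
  rw [Measure.map_apply (measurable_mul_const g) hKo.measurableSet]
  congr 1
  ext x
  exact K.mul_mem_cancel_right hg

/-- Inversion turns a right-invariant measure into a left-invariant one and fixes `K`, so uniqueness
of Haar measure applies. -/
theorem isInvInvariant_of_compactOpen [μ.IsMulRightInvariant] {K : Subgroup G}
    (hK : IsCompact (K : Set G)) (hKo : IsOpen (K : Set G)) : μ.IsInvInvariant := by
  refine ⟨?_⟩
  have : μ.inv.Regular := Measure.Regular.map (Homeomorph.inv G)
  have : μ.inv.IsMulLeftInvariant := inferInstance
  refine eq_of_apply_eq_compactOpen hK hKo ?_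
  rw [Measure.inv_apply]
  simp

end Unimodular

/-! ### Convolution on `L¹`. -/

section Convolution

set_option linter.unusedSectionVars false

variable {G : Type*} [Group G] [TopologicalSpace G] [IsTopologicalGroup G] [LocallyCompactSpace G]
  [T2Space G] [SigmaCompactSpace G] [MeasurableSpace G] [BorelSpace G]
  {μ : Measure G} [μ.IsHaarMeasure] [μ.Regular] [μ.IsMulRightInvariant] [μ.IsInvInvariant]

theorem measurable_inv_mul_baireSpace :
    Measurable[_, baireSpace G] fun p : G × G => p.1⁻¹ * p.2 :=
  measurable_mul_baireSpace.comp (measurable_fst.inv.prodMk measurable_snd)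

theorem measurePreserving_inv_mul (x : G) : MeasurePreserving (fun y => y⁻¹ * x) μ μ :=
  (measurePreserving_mul_right μ x).comp (Measure.measurePreserving_inv μ)

theorem ae_inv_mul {p : G → Prop} (h : ∀ᵐ x ∂μ, p x) (x : G) : ∀ᵐ y ∂μ, p (y⁻¹ * x) :=
  (measurePreserving_inv_mul x).quasiMeasurePreserving.ae h

/-- Replacing `g` by a Baire representative changes the inner integral for no `x` at all, since `y ↦
y⁻¹ * x` preserves `μ`; the new integrand is jointly measurable. -/
theorem aemeasurable_lintegral_conv {f g : G → ℝ≥0∞} (hf : AEMeasurable f μ)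
    (hg : AEMeasurable g μ) : AEMeasurable (fun x => ∫⁻ y, f y * g (y⁻¹ * x) ∂μ) μ := by
  obtain ⟨g', hg', hgg'⟩ := aemeasurable_baireSpace hg
  have h : (fun x => ∫⁻ y, f y * g (y⁻¹ * x) ∂μ) = fun x => ∫⁻ y, f y * g' (y⁻¹ * x) ∂μ :=
    funext fun x => lintegral_congr_ae ((ae_inv_mul hgg' x).mono fun y hy => by simp only [hy])
  rw [h]
  have h2 : Measurable fun p : G × G => g' (p.2⁻¹ * p.1) :=
    hg'.comp (measurable_inv_mul_baireSpace.comp measurable_swap)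
  exact AEMeasurable.lintegral_prod_right' (f := fun p : G × G => f p.2 * g' (p.2⁻¹ * p.1))
    (hf.comp_snd.mul h2.aemeasurable)

theorem lintegral_conv_swap {u f g : G → ℝ≥0∞} (hu : AEMeasurable u μ) (hf : AEMeasurable f μ)
    (hg : AEMeasurable g μ) :
    ∫⁻ x, u x * ∫⁻ y, f y * g (y⁻¹ * x) ∂μ ∂μ = ∫⁻ y, f y * ∫⁻ x, u x * g (y⁻¹ * x) ∂μ ∂μ := by
  obtain ⟨g', hg', hgg'⟩ := aemeasurable_baireSpace hg
  have h2 : Measurable fun p : G × G => g' (p.2⁻¹ * p.1) :=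
    hg'.comp (measurable_inv_mul_baireSpace.comp measurable_swap)
  calc ∫⁻ x, u x * ∫⁻ y, f y * g (y⁻¹ * x) ∂μ ∂μ
      = ∫⁻ x, ∫⁻ y, u x * (f y * g' (y⁻¹ * x)) ∂μ ∂μ := by
        refine lintegral_congr fun x => ?_
        rw [lintegral_const_mul'']
        · congr 1
          exact lintegral_congr_ae ((ae_inv_mul hgg' x).mono fun y hy => by simp only [hy])
        · exact hf.mul (h2.comp measurable_prodMk_left).aemeasurable
    _ = ∫⁻ y, ∫⁻ x, u x * (f y * g' (y⁻¹ * x)) ∂μ ∂μ :=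
        lintegral_lintegral_swap (f := fun x y => u x * (f y * g' (y⁻¹ * x)))
          (hu.comp_fst.mul (hf.comp_snd.mul h2.aemeasurable))
    _ = ∫⁻ y, f y * ∫⁻ x, u x * g (y⁻¹ * x) ∂μ ∂μ := by
        refine lintegral_congr fun y => ?_
        rw [← lintegral_const_mul'']
        · refine lintegral_congr_ae ?_
          have := (measurePreserving_mul_left μ y⁻¹).quasiMeasurePreserving.ae hgg'
          filter_upwards [this] with x hx
          rw [hx]; ring
        · exact hu.mul (hg.comp_quasiMeasurePreserving
            (measurePreserving_mul_left μ y⁻¹).quasiMeasurePreserving)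

theorem lintegral_conv {f g : G → ℝ≥0∞} (hf : AEMeasurable f μ) (hg : AEMeasurable g μ) :
    ∫⁻ x, ∫⁻ y, f y * g (y⁻¹ * x) ∂μ ∂μ = (∫⁻ x, f x ∂μ) * ∫⁻ x, g x ∂μ := by
  have h := lintegral_conv_swap (u := fun _ => 1) aemeasurable_const hf hg
  simp only [one_mul] at h
  rw [h, ← lintegral_mul_const'' _ hf]
  refine lintegral_congr fun y => ?_
  rw [lintegral_mul_left_eq_self]

theorem groupConv_congr {f f' g g' : G → ℂ} (hf : f =ᵐ[μ] f') (hg : g =ᵐ[μ] g') :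
    groupConv μ f g = groupConv μ f' g' :=
  funext fun x => integral_congr_ae (by
    filter_upwards [hf, ae_inv_mul hg x] with y hy hy'
    rw [hy, hy'])

theorem aestronglyMeasurable_groupConv {f g : G → ℂ} (hf : AEStronglyMeasurable f μ)
    (hg : AEStronglyMeasurable g μ) : AEStronglyMeasurable (groupConv μ f g) μ := by
  obtain ⟨g', hg', hgg'⟩ := aestronglyMeasurable_baireSpace hg
  rw [groupConv_congr (ae_eq_refl f) hgg']
  have h2 : StronglyMeasurable fun p : G × G => g' (p.2⁻¹ * p.1) :=
    hg'.comp_measurable (measurable_inv_mul_baireSpace.comp measurable_swap)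
  exact AEStronglyMeasurable.integral_prod_right'
    (f := fun p : G × G => f p.2 * g' (p.2⁻¹ * p.1)) (hf.comp_snd.mul h2.aestronglyMeasurable)

theorem enorm_groupConv_le (f g : G → ℂ) (x : G) :
    ‖groupConv μ f g x‖ₑ ≤ ∫⁻ y, ‖f y‖ₑ * ‖g (y⁻¹ * x)‖ₑ ∂μ :=
  (enorm_integral_le_lintegral_enorm _).trans_eq (lintegral_congr fun _ => enorm_mul _ _)

theorem lintegral_enorm_groupConv_le {f g : G → ℂ} (hf : AEStronglyMeasurable f μ)
    (hg : AEStronglyMeasurable g μ) :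
    ∫⁻ x, ‖groupConv μ f g x‖ₑ ∂μ ≤ (∫⁻ x, ‖f x‖ₑ ∂μ) * ∫⁻ x, ‖g x‖ₑ ∂μ := by
  rw [← lintegral_conv hf.enorm hg.enorm]
  exact lintegral_mono (enorm_groupConv_le f g)

theorem MeasureTheory.Integrable.groupConv {f g : G → ℂ} (hf : Integrable f μ)
    (hg : Integrable g μ) : Integrable (groupConv μ f g) μ :=
  ⟨aestronglyMeasurable_groupConv hf.1 hg.1,
    (lintegral_enorm_groupConv_le hf.1 hg.1).trans_lt (ENNReal.mul_lt_top hf.2 hg.2)⟩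

theorem ae_lintegral_conv_lt_top {f g : G → ℝ≥0∞} (hf : AEMeasurable f μ) (hg : AEMeasurable g μ)
    (hf' : ∫⁻ x, f x ∂μ ≠ ∞) (hg' : ∫⁻ x, g x ∂μ ≠ ∞) :
    ∀ᵐ x ∂μ, ∫⁻ y, f y * g (y⁻¹ * x) ∂μ < ∞ :=
  ae_lt_top' (aemeasurable_lintegral_conv hf hg)
    (by rw [lintegral_conv hf hg]; exact ENNReal.mul_ne_top hf' hg')

theorem aestronglyMeasurable_conv_integrand {f g : G → ℂ} (hf : AEStronglyMeasurable f μ)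
    (hg : AEStronglyMeasurable g μ) (x : G) :
    AEStronglyMeasurable (fun y => f y * g (y⁻¹ * x)) μ :=
  hf.mul (hg.comp_quasiMeasurePreserving (measurePreserving_inv_mul x).quasiMeasurePreserving)

theorem ae_integrable_conv_integrand {f g : G → ℂ} (hf : Integrable f μ) (hg : Integrable g μ) :
    ∀ᵐ x ∂μ, Integrable (fun y => f y * g (y⁻¹ * x)) μ := by
  filter_upwards [ae_lintegral_conv_lt_top hf.1.enorm hg.1.enorm hf.2.ne hg.2.ne] with x hx
  refine ⟨aestronglyMeasurable_conv_integrand hf.1 hg.1 x, ?_⟩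
  simpa only [HasFiniteIntegral, enorm_mul] using hx

theorem groupConv_add_left {f f' g : G → ℂ} (hf : Integrable f μ) (hf' : Integrable f' μ)
    (hg : Integrable g μ) :
    groupConv μ (f + f') g =ᵐ[μ] groupConv μ f g + groupConv μ f' g := by
  filter_upwards [ae_integrable_conv_integrand hf hg, ae_integrable_conv_integrand hf' hg]
    with x hx hx'
  simp only [groupConv, Pi.add_apply, add_mul]
  exact integral_add hx hx'

theorem groupConv_add_right {f g g' : G → ℂ} (hf : Integrable f μ) (hg : Integrable g μ)
    (hg' : Integrable g' μ) :
    groupConv μ f (g + g') =ᵐ[μ] groupConv μ f g + groupConv μ f g' := by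
  filter_upwards [ae_integrable_conv_integrand hf hg, ae_integrable_conv_integrand hf hg']
    with x hx hx'
  simp only [groupConv, Pi.add_apply, mul_add]
  exact integral_add hx hx'

theorem groupConv_smul_left (c : ℂ) (f g : G → ℂ) :
    groupConv μ (c • f) g = c • groupConv μ f g := by
  ext x
  simp only [groupConv, Pi.smul_apply, smul_eq_mul, mul_assoc, integral_const_mul]

theorem groupConv_smul_right (c : ℂ) (f g : G → ℂ) :
    groupConv μ f (c • g) = c • groupConv μ f g := by
  ext x
  simp only [groupConv, Pi.smul_apply, smul_eq_mul, mul_left_comm _ c, integral_const_mul]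

/-- Convolution of integrable functions is associative. -/
theorem groupConv_assoc {f g k : G → ℂ} (hf : Integrable f μ) (hg : Integrable g μ)
    (hk : Integrable k μ) :
    groupConv μ (groupConv μ f g) k =ᵐ[μ] groupConv μ f (groupConv μ g k) := by
  obtain ⟨g', hg', hgg'⟩ := aestronglyMeasurable_baireSpace hg.1
  have h2 : StronglyMeasurable fun p : G × G => g' (p.2⁻¹ * p.1) :=
    hg'.comp_measurable (measurable_inv_mul_baireSpace.comp measurable_swap)
  have hgi' := hg.congr hgg'
  rw [groupConv_congr (ae_eq_refl f) hgg', groupConv_congr hgg' (ae_eq_refl k)]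
  have hfin := ae_lintegral_conv_lt_top
    (aemeasurable_lintegral_conv hf.1.enorm hgi'.1.enorm) hk.1.enorm
    (by rw [lintegral_conv hf.1.enorm hgi'.1.enorm]; exact ENNReal.mul_ne_top hf.2.ne hgi'.2.ne)
    hk.2.ne
  filter_upwards [hfin] with x hx
  have hkx : AEStronglyMeasurable (fun y => k (y⁻¹ * x)) μ :=
    hk.1.comp_quasiMeasurePreserving (measurePreserving_inv_mul x).quasiMeasurePreserving
  have hmeas : AEStronglyMeasurable
      (fun p : G × G => f p.2 * g' (p.2⁻¹ * p.1) * k (p.1⁻¹ * x)) (μ.prod μ) :=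
    (hf.1.comp_snd.mul h2.aestronglyMeasurable).mul hkx.comp_fst
  -- Absolute integrability at this `x` is the finiteness of the triple convolution of absolute
  -- values, which holds almost everywhere.
  have hint : Integrable (Function.uncurry fun y z : G => f z * g' (z⁻¹ * y) * k (y⁻¹ * x))
      (μ.prod μ) := by
    refine ⟨hmeas, ?_⟩
    refine (lintegral_prod _ hmeas.enorm).trans_lt ?_
    refine lt_of_eq_of_lt (lintegral_congr fun y => ?_) hx
    simp only [enorm_mul]
    rw [lintegral_mul_const'']
    exact hf.1.enorm.mul (hgi'.1.comp_quasiMeasurePreserving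
      (measurePreserving_inv_mul y).quasiMeasurePreserving).enorm
  calc groupConv μ (groupConv μ f g') k x
      = ∫ y, ∫ z, f z * g' (z⁻¹ * y) * k (y⁻¹ * x) ∂μ ∂μ := by
        simp only [groupConv, integral_mul_const]
    _ = ∫ z, ∫ y, f z * g' (z⁻¹ * y) * k (y⁻¹ * x) ∂μ ∂μ := integral_integral_swap hint
    _ = groupConv μ f (groupConv μ g' k) x := by
        refine integral_congr_ae (Eventually.of_forall fun z => ?_)
        simp only [groupConv, mul_assoc, integral_const_mul]
        congr 1
        rw [← integral_mul_left_eq_self _ z]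
        simp only [inv_mul_cancel_left, mul_inv_rev, mul_assoc]

/-- Convolution as a bounded bilinear map on `L¹`. -/
noncomputable def l1Conv (μ : Measure G) [μ.IsHaarMeasure] [μ.Regular] [μ.IsMulRightInvariant]
    [μ.IsInvInvariant] : (G →₁[μ] ℂ) →L[ℂ] (G →₁[μ] ℂ) →L[ℂ] (G →₁[μ] ℂ) :=
  LinearMap.mkContinuous₂
    (LinearMap.mk₂ ℂ
      (fun f g => ((L1.integrable_coeFn f).groupConv (L1.integrable_coeFn g)).toL1 _)
      (fun f f' g => by
        rw [← Integrable.toL1_add, Integrable.toL1_eq_toL1_iff,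
          groupConv_congr (Lp.coeFn_add f f') (ae_eq_refl _)]
        exact groupConv_add_left (L1.integrable_coeFn f) (L1.integrable_coeFn f')
          (L1.integrable_coeFn g))
      (fun c f g => by
        rw [← Integrable.toL1_smul', Integrable.toL1_eq_toL1_iff,
          groupConv_congr (Lp.coeFn_smul c f) (ae_eq_refl _), groupConv_smul_left])
      (fun f g g' => by
        rw [← Integrable.toL1_add, Integrable.toL1_eq_toL1_iff,
          groupConv_congr (ae_eq_refl _) (Lp.coeFn_add g g')]
        exact groupConv_add_right (L1.integrable_coeFn f) (L1.integrable_coeFn g)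
          (L1.integrable_coeFn g'))
      (fun c f g => by
        rw [← Integrable.toL1_smul', Integrable.toL1_eq_toL1_iff,
          groupConv_congr (ae_eq_refl _) (Lp.coeFn_smul c g), groupConv_smul_right]))
    1 (fun f g => by
      rw [one_mul, LinearMap.mk₂_apply, Integrable.norm_toL1_eq_lintegral_enorm, L1.norm_def,
        L1.norm_def, ← ENNReal.toReal_mul]
      exact ENNReal.toReal_mono
        (ENNReal.mul_ne_top (L1.integrable_coeFn f).2.ne (L1.integrable_coeFn g).2.ne)
        (lintegral_enorm_groupConv_le (L1.integrable_coeFn f).1 (L1.integrable_coeFn g).1))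

theorem coeFn_l1Conv (f g : G →₁[μ] ℂ) : l1Conv μ f g =ᵐ[μ] groupConv μ f g :=
  Integrable.coeFn_toL1 ((L1.integrable_coeFn f).groupConv (L1.integrable_coeFn g))

theorem l1Conv_toL1 {f g : G → ℂ} (hf : Integrable f μ) (hg : Integrable g μ) :
    l1Conv μ (hf.toL1 f) (hg.toL1 g) = (hf.groupConv hg).toL1 _ := by
  refine Lp.ext ((coeFn_l1Conv _ _).trans ?_)
  rw [groupConv_congr hf.coeFn_toL1 hg.coeFn_toL1]
  exact (hf.groupConv hg).coeFn_toL1.symm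

theorem l1Conv_assoc (f g k : G →₁[μ] ℂ) :
    l1Conv μ (l1Conv μ f g) k = l1Conv μ f (l1Conv μ g k) := by
  refine Lp.ext ((coeFn_l1Conv _ _).trans (EventuallyEq.trans ?_ (coeFn_l1Conv _ _).symm))
  rw [groupConv_congr (coeFn_l1Conv f g) (ae_eq_refl _),
    groupConv_congr (ae_eq_refl _) (coeFn_l1Conv g k)]
  exact groupConv_assoc (L1.integrable_coeFn f) (L1.integrable_coeFn g) (L1.integrable_coeFn k)

end Convolution

/-! ### The ultrametric weight attached to the decomposition. -/

section Sharp

set_option linter.unusedSectionVars false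

variable {G : Type*} [Group G] [TopologicalSpace G] {K : ℕ → Subgroup G}

namespace IsStandardDecomposition

theorem monotone (hK : IsStandardDecomposition K) : Monotone K :=
  monotone_nat_of_le_succ hK.le_succ

theorem exists_mem (hK : IsStandardDecomposition K) (x : G) : ∃ i, x ∈ K i := by
  have : x ∈ ⋃ i, (K i : Set G) := hK.iUnion_eq ▸ mem_univ x
  simpa using this

theorem mem_zero_or (hK : IsStandardDecomposition K) (x : G) :
    x ∈ K 0 ∨ ∃ i, x ∈ K (i + 1) ∧ x ∉ K i := by
  classical
  have h := hK.exists_mem x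
  rcases h0 : Nat.find h with _ | i
  · exact Or.inl (h0 ▸ Nat.find_spec h)
  · exact Or.inr ⟨i, h0 ▸ Nat.find_spec h, Nat.find_min h (by omega)⟩

theorem sigmaCompactSpace (hK : IsStandardDecomposition K) : SigmaCompactSpace G :=
  ⟨⟨fun i => K i, hK.isCompact, hK.iUnion_eq⟩⟩

theorem bddAbove_image [MeasurableSpace G] (hK : IsStandardDecomposition K) {ω : G → ℝ}
    (hω : IsWeight ω) (i : ℕ) : BddAbove (ω '' (K i : Set G)) :=
  hω.bddAbove _ (hK.isCompact i)

theorem le_sSup [MeasurableSpace G] (hK : IsStandardDecomposition K) {ω : G → ℝ}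
    (hω : IsWeight ω) {i : ℕ} {x : G} (hx : x ∈ K i) : ω x ≤ sSup (ω '' (K i : Set G)) :=
  _root_.le_csSup (hK.bddAbove_image hω i) ⟨x, hx, rfl⟩

theorem one_le_sSup [MeasurableSpace G] (hK : IsStandardDecomposition K) {ω : G → ℝ}
    (hω : IsWeight ω) (i : ℕ) : 1 ≤ sSup (ω '' (K i : Set G)) :=
  (hω.one_le 1).trans (hK.le_sSup hω (K i).one_mem)

theorem sSup_mono [MeasurableSpace G] (hK : IsStandardDecomposition K) {ω : G → ℝ}
    (hω : IsWeight ω) {i j : ℕ} (h : i ≤ j) :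
    sSup (ω '' (K i : Set G)) ≤ sSup (ω '' (K j : Set G)) :=
  csSup_le_csSup (hK.bddAbove_image hω j) ⟨ω 1, 1, (K i).one_mem, rfl⟩
    (image_mono (hK.monotone h))

theorem sharpOne_of_mem_zero [MeasurableSpace G] (hK : IsStandardDecomposition K) (μ : Measure G)
    (ω : G → ℝ) {x : G} (hx : x ∈ K 0) :
    sharpOne μ K ω x = sSup (ω '' (K 0 : Set G)) + 1 := by
  have h : ∀ i : ℕ, x ∉ ((K (i + 1) : Set G) \ (K i : Set G)) := fun i hi =>
    hi.2 (hK.monotone (Nat.zero_le i) hx)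
  simp only [sharpOne, indicator_of_notMem (h _), tsum_zero, add_zero]
  exact indicator_of_mem (s := (K 0 : Set G)) hx _

theorem sharpOne_of_mem_diff [MeasurableSpace G] (hK : IsStandardDecomposition K) (μ : Measure G)
    (ω : G → ℝ) {x : G} {i : ℕ} (hx : x ∈ K (i + 1)) (hx' : x ∉ K i) :
    sharpOne μ K ω x = (sSup (ω '' (K (i + 1) : Set G)) + ((i : ℝ) + 2) ^ 2) *
        (μ.real ((K (i + 1) : Set G) \ (K i : Set G)) / μ.real (K 0 : Set G)) := by
  have h0 : x ∉ (K 0 : Set G) := fun h => hx' (hK.monotone (Nat.zero_le i) h)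
  rw [sharpOne, indicator_of_notMem h0, zero_add, tsum_eq_single i]
  · exact indicator_of_mem (s := (K (i + 1) : Set G) \ (K i : Set G)) ⟨hx, hx'⟩ _
  intro j hj
  refine indicator_of_notMem (fun hxj => ?_) _
  rcases lt_or_gt_of_ne hj with h | h
  · exact hx' (hK.monotone h hxj.1)
  · exact hxj.2 (hK.monotone h hx)

section Haar

variable [IsTopologicalGroup G] [LocallyCompactSpace G] [MeasurableSpace G] [BorelSpace G]
  {μ : Measure G} [μ.IsHaarMeasure]

/-- An open subgroup of a compact group has finite index, and its cosets have equal measure. -/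
theorem relIndex_mul_measure {H L : Subgroup G} (hHL : H ≤ L) (hL : IsCompact (L : Set G))
    (hH : IsOpen (H : Set G)) (hLo : IsOpen (L : Set G)) : H.relIndex L * μ H = μ L := by
  have hemb : MeasurableEmbedding ((↑) : L → G) := .subtype_coe hLo.measurableSet
  have : CompactSpace L := isCompact_iff_compactSpace.1 hL
  have hHo : IsOpen (H.subgroupOf L : Set L) := hH.preimage continuous_subtype_val
  have : Finite (L ⧸ H.subgroupOf L) := Subgroup.quotient_finite_of_isOpen _ hHo
  have : (H.subgroupOf L).FiniteIndex := Subgroup.finiteIndex_of_finite_quotient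
  have : (μ.comap ((↑) : L → G)).IsMulLeftInvariant :=
    Measure.IsMulLeftInvariant.comap μ (f := L.subtype) hemb
  have h := (H.subgroupOf L).index_mul_measure hHo.measurableSet (μ.comap ((↑) : L → G))
  rw [hemb.comap_apply, hemb.comap_apply, image_univ, Subtype.range_coe] at h
  rw [← h]
  congr 2
  ext x
  simp only [SetLike.mem_coe, mem_image, Subgroup.mem_subgroupOf, Subtype.exists, exists_and_left,
    exists_prop, exists_eq_right_right]
  exact ⟨fun hx => ⟨hx, hHL hx⟩, fun hx => hx.1⟩

theorem measureReal_pos (hK : IsStandardDecomposition K) (i : ℕ) : 0 < μ.real (K i : Set G) :=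
  ENNReal.toReal_pos ((hK.isOpen i).measure_pos μ ⟨1, (K i).one_mem⟩).ne'
    (hK.isCompact i).measure_lt_top.ne

theorem measureReal_mono (hK : IsStandardDecomposition K) {i j : ℕ} (h : i ≤ j) :
    μ.real (K i : Set G) ≤ μ.real (K j : Set G) :=
  MeasureTheory.measureReal_mono (hK.monotone h) (hK.isCompact j).measure_lt_top.ne

theorem relIndex_mul_measureReal (hK : IsStandardDecomposition K) (i : ℕ) :
    (K i).relIndex (K (i + 1)) * μ.real (K i : Set G) = μ.real (K (i + 1) : Set G) := by
  have h := congrArg ENNReal.toReal (relIndex_mul_measure (μ := μ) (hK.le_succ i)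
    (hK.isCompact (i + 1)) (hK.isOpen i) (hK.isOpen (i + 1)))
  rwa [ENNReal.toReal_mul, ENNReal.toReal_natCast] at h

theorem measureReal_diff (hK : IsStandardDecomposition K) (i : ℕ) :
    μ.real ((K (i + 1) : Set G) \ (K i : Set G)) =
      (((K i).relIndex (K (i + 1)) : ℝ) - 1) * μ.real (K i : Set G) := by
  rw [measureReal_sdiff (hK.le_succ i) (hK.isOpen i).measurableSet
    (hK.isCompact (i + 1)).measure_lt_top.ne, ← hK.relIndex_mul_measureReal]
  ring

/-- The shell has measure `([K_{i+1} : K_i] - 1) μ(K_i)`; both factors are non-decreasing, the first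
by monotonicity of the indices. -/
theorem measureReal_diff_mono (hK : IsStandardDecomposition K) {i j : ℕ} (h : i ≤ j) :
    μ.real ((K (i + 1) : Set G) \ (K i : Set G)) ≤
      μ.real ((K (j + 1) : Set G) \ (K j : Set G)) := by
  have h0 : 0 ≤ μ.real ((K (i + 1) : Set G) \ (K i : Set G)) := measureReal_nonneg
  have hi := hK.measureReal_pos (μ := μ) i
  rw [hK.measureReal_diff] at h0 ⊢
  rw [hK.measureReal_diff]
  have h1 : ((K i).relIndex (K (i + 1)) : ℝ) ≤ (K j).relIndex (K (j + 1)) := by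
    exact_mod_cast hK.index_mono h
  have h2 := nonneg_of_mul_nonneg_left h0 hi
  exact mul_le_mul (by linarith) (hK.measureReal_mono h) hi.le (by linarith)

/-- A nonempty shell forces index at least 2, so the shell is at least as large as `K i`, hence as
`K 0`. Empty shells are why a point `x` is needed. -/
theorem measureReal_le_diff (hK : IsStandardDecomposition K) {x : G} {i : ℕ} (hx : x ∈ K (i + 1))
    (hx' : x ∉ K i) :
    μ.real (K 0 : Set G) ≤ μ.real ((K (i + 1) : Set G) \ (K i : Set G)) := by
  have hi := hK.measureReal_pos (μ := μ) i
  have hi' := hK.measureReal_pos (μ := μ) (i + 1)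
  have h1 : (K i).relIndex (K (i + 1)) ≠ 1 := fun h => hx' (Subgroup.relIndex_eq_one.1 h hx)
  have h0 : (K i).relIndex (K (i + 1)) ≠ 0 := fun h => by
    have := hK.relIndex_mul_measureReal (μ := μ) i
    rw [h, Nat.cast_zero, zero_mul] at this
    exact hi'.ne this
  have h2 : (2 : ℝ) ≤ (K i).relIndex (K (i + 1)) := by
    exact_mod_cast (by omega : 2 ≤ (K i).relIndex (K (i + 1)))
  rw [hK.measureReal_diff]
  refine (hK.measureReal_mono (Nat.zero_le i)).trans (le_mul_of_one_le_left hi.le (by linarith))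

variable {ω : G → ℝ}

/-- The function `ω♯₁` only depends on the position of a point in the decomposition, and it is
monotone in this position. -/
theorem sharpOne_le (hK : IsStandardDecomposition K) (hω : IsWeight ω) {x y : G}
    (h : ∀ i, y ∈ K i → x ∈ K i) : sharpOne μ K ω x ≤ sharpOne μ K ω y := by
  have h0 := hK.measureReal_pos (μ := μ) 0
  rcases hK.mem_zero_or y with hy | ⟨j, hy, hy'⟩
  · rw [hK.sharpOne_of_mem_zero μ ω hy, hK.sharpOne_of_mem_zero μ ω (h 0 hy)]
  have hj := hK.one_le_sSup hω (j + 1)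
  have hd : 1 ≤ μ.real ((K (j + 1) : Set G) \ (K j : Set G)) / μ.real (K 0 : Set G) :=
    (one_le_div h0).2 (hK.measureReal_le_diff hy hy')
  rw [hK.sharpOne_of_mem_diff μ ω hy hy']
  rcases hK.mem_zero_or x with hx | ⟨i, hx, hx'⟩
  · rw [hK.sharpOne_of_mem_zero μ ω hx]
    have h1 := hK.sSup_mono hω (Nat.zero_le (j + 1))
    refine le_trans ?_ (le_mul_of_one_le_right (by positivity) hd)
    nlinarith [(Nat.cast_nonneg j : (0 : ℝ) ≤ j)]
  · have hij : i ≤ j := by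
      by_contra! hji
      exact hx' (hK.monotone hji (h _ hy))
    have hij' : (i : ℝ) ≤ j := by exact_mod_cast hij
    rw [hK.sharpOne_of_mem_diff μ ω hx hx']
    have hs := hK.sSup_mono hω (Nat.succ_le_succ hij)
    have hdd := hK.measureReal_diff_mono (μ := μ) hij
    gcongr

theorem le_sharpOne (hK : IsStandardDecomposition K) (hω : IsWeight ω) (x : G) :
    ω x ≤ sharpOne μ K ω x := by
  rcases hK.mem_zero_or x with hx | ⟨i, hx, hx'⟩
  · rw [hK.sharpOne_of_mem_zero μ ω hx]
    linarith [hK.le_sSup hω hx]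
  · have hd : 1 ≤ μ.real ((K (i + 1) : Set G) \ (K i : Set G)) / μ.real (K 0 : Set G) :=
      (one_le_div (hK.measureReal_pos 0)).2 (hK.measureReal_le_diff hx hx')
    have h1 := hK.one_le_sSup hω (i + 1)
    rw [hK.sharpOne_of_mem_diff μ ω hx hx']
    refine le_trans ?_ (le_mul_of_one_le_right (by positivity) hd)
    exact (hK.le_sSup hω hx).trans (le_add_of_nonneg_right (sq_nonneg _))

/-- The subgroups form a chain, so one of `x`, `y` lies in every `K i` containing the other; then so
does `x * y`. -/
theorem sharpOne_mul_le_max (hK : IsStandardDecomposition K) (hω : IsWeight ω) (x y : G) :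
    sharpOne μ K ω (x * y) ≤ max (sharpOne μ K ω x) (sharpOne μ K ω y) := by
  by_cases h : ∀ i, y ∈ K i → x ∈ K i
  · exact (hK.sharpOne_le hω fun i hi => (K i).mul_mem (h i hi) hi).trans (le_max_right _ _)
  · refine (hK.sharpOne_le hω fun i hi => (K i).mul_mem hi ?_).trans (le_max_left _ _)
    push Not at h
    obtain ⟨j, hy, hx⟩ := h
    refine hK.monotone (le_of_not_ge fun hij => hx (hK.monotone hij hi)) hy

/-- The position in the chain is constant on cosets of the open subgroup `K 0`, so the function is
locally constant. -/
theorem continuous_sharpOne (hK : IsStandardDecomposition K) (hω : IsWeight ω) :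
    Continuous (sharpOne μ K ω) := by
  refine IsLocallyConstant.continuous ((IsLocallyConstant.iff_exists_open _).2 fun x =>
    ⟨(x⁻¹ * ·) ⁻¹' (K 0 : Set G), (hK.isOpen 0).preimage (continuous_const_mul _), ?_, ?_⟩)
  · simp [(K 0).one_mem]
  · intro y hy
    have hxy : ∀ i, y ∈ K i ↔ x ∈ K i := fun i => by
      have : x⁻¹ * y ∈ K i := hK.monotone (Nat.zero_le i) hy
      simpa only [mul_inv_cancel_left] using mul_mem_cancel_right (y := x) this
    exact le_antisymm (hK.sharpOne_le hω fun i => (hxy i).2)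
      (hK.sharpOne_le hω fun i => (hxy i).1)

theorem isSubadditiveWeight_sharpOne (hK : IsStandardDecomposition K) (hω : IsWeight ω) :
    IsSubadditiveWeight (sharpOne μ K ω) := by
  have h1 : ∀ x, 1 ≤ sharpOne μ K ω x := fun x => (hω.one_le x).trans (hK.le_sharpOne hω x)
  refine ⟨⟨(hK.continuous_sharpOne hω).measurable, h1,
    fun S hS => hS.bddAbove_image (hK.continuous_sharpOne hω).continuousOn, fun x y => ?_,
    fun x => ?_⟩, 1, one_pos, fun x y => ?_⟩
  · refine (hK.sharpOne_mul_le_max hω x y).trans (max_le ?_ ?_)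
    · exact le_mul_of_one_le_right (by linarith [h1 x]) (h1 y)
    · exact le_mul_of_one_le_left (by linarith [h1 y]) (h1 x)
  · exact le_antisymm (hK.sharpOne_le hω fun i => (K i).inv_mem)
      (hK.sharpOne_le hω fun i hi => (inv_mem_iff (H := K i)).1 hi)
  · refine (hK.sharpOne_mul_le_max hω x y).trans (max_le ?_ ?_)
    · linarith [h1 y]
    · linarith [h1 x]

end Haar

end IsStandardDecomposition

end Sharp

/-! ### Submultiplicative sequences and powers of operators. -/

/-- A submultiplicative sequence with one term less than `1` is summable. -/
theorem ENNReal.tsum_ne_top_of_submultiplicative {a : ℕ → ℝ≥0∞}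
    (hmul : ∀ n m, a (n + m + 1) ≤ a n * a m) (hfin : ∀ n, a n ≠ ∞) {N : ℕ} (hN : a N < 1) :
    ∑' n, a n ≠ ∞ := by
  -- Index `n` stands for an `(n + 1)`-st power, so multiplying by the term at `N` shifts the index
  -- by `N + 1`; division with remainder by `N + 1` then gives finitely many geometric series.
  have hstep : ∀ k j, a (k * (N + 1) + j) ≤ a N ^ k * a j := by
    intro k
    induction k with
    | zero => intro j; simp
    | succ k ih =>
      intro j
      have h : (k + 1) * (N + 1) + j = N + (k * (N + 1) + j) + 1 := by ring
      rw [h, pow_succ', mul_assoc]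
      exact (hmul _ _).trans (by gcongr; exact ih j)
  have h1 : ∑' n, a n = ∑' p : ℕ × Fin (N + 1), a (p.1 * (N + 1) + p.2) :=
    ((Nat.divModEquiv (N + 1)).symm.tsum_eq a).symm
  rw [h1]
  have h2 : ∑' p : ℕ × Fin (N + 1), a (p.1 * (N + 1) + p.2) ≤
      ∑' p : ℕ × Fin (N + 1), a N ^ p.1 * a p.2 :=
    ENNReal.tsum_le_tsum fun p => hstep p.1 p.2
  refine ne_top_of_le_ne_top ?_ h2
  rw [ENNReal.tsum_prod (f := fun (k : ℕ) (j : Fin (N + 1)) => a N ^ k * a j)]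
  simp_rw [ENNReal.tsum_mul_left]
  rw [ENNReal.tsum_mul_right, ENNReal.tsum_geometric, tsum_fintype]
  exact ENNReal.mul_ne_top (ENNReal.inv_ne_top.2 (tsub_pos_of_lt hN).ne')
    (ENNReal.sum_ne_top.2 fun j _ => hfin j)

/-- The powers of an operator of spectral radius less than `1` tend to zero. -/
theorem tendsto_pow_norm_of_spectralRadius_lt_one {A : Type*} [NormedRing A] [NormedAlgebra ℂ A]
    [CompleteSpace A] {a : A} (h : spectralRadius ℂ a < 1) :
    Tendsto (fun n : ℕ => ‖a ^ n‖ₑ) atTop (𝓝 0) := by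
  obtain ⟨ρ, hρ, hρ1⟩ := exists_between h
  have hlim := spectrum.pow_nnnorm_pow_one_div_tendsto_nhds_spectralRadius a
  refine tendsto_of_tendsto_of_tendsto_of_le_of_le' tendsto_const_nhds
    (ENNReal.tendsto_pow_atTop_nhds_zero_of_lt_one hρ1) (Eventually.of_forall fun _ => zero_le) ?_
  filter_upwards [hlim.eventually_lt_const hρ, eventually_gt_atTop 0] with n hn hn0
  have hn' : (0 : ℝ) < n := by exact_mod_cast hn0
  rw [← ENNReal.rpow_natCast]
  have := ENNReal.rpow_le_rpow hn.le hn'.le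
  rwa [← ENNReal.rpow_mul, one_div_mul_cancel hn'.ne', ENNReal.rpow_one] at this

/-! ### Monotonicity of weighted norms and countable subadditivity. -/

section Series

variable {G : Type*} [MeasurableSpace G] {μ : Measure G} {Φ : ℝ → ℝ≥0∞} {v : G → ℝ}

theorem weightedOrliczNorm_mono_ae {f g : G → ℂ} (h : ∀ᵐ x ∂μ, ‖f x‖ₑ ≤ ‖g x‖ₑ) :
    weightedOrliczNorm μ Φ v f ≤ weightedOrliczNorm μ Φ v g :=
  orliczNorm_mono (h.mono fun x hx => by simp only [enorm_mul]; gcongr)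

theorem weightedOrliczNorm_congr {f g : G → ℂ} (h : f =ᵐ[μ] g) :
    weightedOrliczNorm μ Φ v f = weightedOrliczNorm μ Φ v g :=
  (weightedOrliczNorm_mono_ae (h.mono fun x hx => by rw [hx])).antisymm
    (weightedOrliczNorm_mono_ae (h.mono fun x hx => by rw [hx]))

theorem weightedOrliczNorm_mono_weight {w : G → ℝ} (hv : ∀ x, 0 ≤ v x) (h : ∀ x, v x ≤ w x)
    (f : G → ℂ) : weightedOrliczNorm μ Φ v f ≤ weightedOrliczNorm μ Φ w f := by
  refine orliczNorm_mono (Eventually.of_forall fun x => ?_)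
  rw [enorm_mul, enorm_mul]
  gcongr
  rw [enorm_le_iff_norm_le, Complex.norm_real, Complex.norm_real, Real.norm_of_nonneg (hv x),
    Real.norm_of_nonneg ((hv x).trans (h x))]
  exact h x

theorem orliczNorm_le_weightedOrliczNorm (hv : ∀ x, 1 ≤ v x) (f : G → ℂ) :
    orliczNorm μ Φ f ≤ weightedOrliczNorm μ Φ v f := by
  have h := weightedOrliczNorm_mono_weight (μ := μ) (Φ := Φ) (v := fun _ => 1) (w := v)
    (fun _ => zero_le_one) hv f
  simpa [weightedOrliczNorm] using h

/-- In `L¹`, the sum of a convergent series is pointwise dominated by the series of absolute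
values. -/
theorem ae_enorm_tsum_le {p : ℕ → G →₁[μ] ℂ} (hp : Summable p) :
    ∀ᵐ x ∂μ, ‖(∑' n, p n : G →₁[μ] ℂ) x‖ₑ ≤ ∑' n, ‖p n x‖ₑ := by
  -- Convergence in `L¹` implies convergence in measure, hence almost everywhere along a subsequence
  -- of the partial sums.
  obtain ⟨ns, -, hns⟩ :=
    (tendstoInMeasure_of_tendsto_Lp hp.hasSum.tendsto_sum_nat).exists_seq_tendsto_ae
  have hsum : ∀ᵐ x ∂μ, ∀ N : ℕ,
      (∑ n ∈ Finset.range N, p n : G →₁[μ] ℂ) x = ∑ n ∈ Finset.range N, p n x := by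
    refine ae_all_iff.2 fun N => ?_
    filter_upwards [Lp.coeFn_finsetSum (Finset.range N) p] with x hx
    rw [hx, Finset.sum_apply]
  filter_upwards [hns, hsum] with x hx hx'
  refine le_of_tendsto' hx.enorm fun k => ?_
  rw [hx']
  exact (enorm_sum_le _ _).trans (ENNReal.sum_le_tsum _)

theorem weightedOrliczNorm_tsum_le (hv : Measurable v) {p : ℕ → G →₁[μ] ℂ} (hp : Summable p) :
    weightedOrliczNorm μ Φ v (∑' n, p n : G →₁[μ] ℂ) ≤ ∑' n, weightedOrliczNorm μ Φ v (p n) := by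
  refine iSup_le fun u => iSup_le fun hu => iSup_le fun huΨ => ?_
  have hvc : AEStronglyMeasurable (fun x => (v x : ℂ)) μ :=
    (Complex.measurable_ofReal.comp hv).aestronglyMeasurable
  calc ∫⁻ x, ‖(∑' n, p n : G →₁[μ] ℂ) x * (v x : ℂ) * u x‖ₑ ∂μ
      ≤ ∫⁻ x, ∑' n, ‖p n x * (v x : ℂ) * u x‖ₑ ∂μ := by
        refine lintegral_mono_ae ((ae_enorm_tsum_le hp).mono fun x hx => ?_)
        simp only [enorm_mul, ENNReal.tsum_mul_right]
        gcongr
    _ = ∑' n, ∫⁻ x, ‖p n x * (v x : ℂ) * u x‖ₑ ∂μ :=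
        lintegral_tsum fun n => (((Lp.aestronglyMeasurable (p n)).mul hvc).mul hu).enorm
    _ ≤ _ := ENNReal.tsum_le_tsum fun n => lintegral_le_orliczNorm hu huΨ

end Series

/-! ### Orlicz norms as `L¹`-module norms. -/

section Module

set_option linter.unusedSectionVars false

variable {G : Type*} [Group G] [TopologicalSpace G] [IsTopologicalGroup G] [LocallyCompactSpace G]
  [T2Space G] [SigmaCompactSpace G] [MeasurableSpace G] [BorelSpace G]
  {μ : Measure G} [μ.IsHaarMeasure] [μ.Regular] [μ.IsMulRightInvariant] [μ.IsInvInvariant]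
  {Φ : ℝ → ℝ≥0∞} {v : G → ℝ}

theorem lintegral_mul_enorm_mul_left_le (f : G → ℂ) {u : G → ℂ}
    (hu : AEStronglyMeasurable u μ) (huΨ : ∫⁻ x, youngComplement Φ ‖u x‖ ∂μ ≤ 1) (y : G) :
    ∫⁻ x, ‖f x‖ₑ * ‖u (y * x)‖ₑ ∂μ ≤ orliczNorm μ Φ f := by
  have h := lintegral_le_orliczNorm (f := f) (Φ := Φ) (μ := μ) (g := fun x => u (y * x))
    (hu.comp_quasiMeasurePreserving (measurePreserving_mul_left μ y).quasiMeasurePreserving)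
    (by rwa [lintegral_mul_left_eq_self (fun x => youngComplement Φ ‖u x‖)])
  simpa only [enorm_mul] using h

theorem lintegral_mul_enorm_mul_right_le (f : G → ℂ) {u : G → ℂ}
    (hu : AEStronglyMeasurable u μ) (huΨ : ∫⁻ x, youngComplement Φ ‖u x‖ ∂μ ≤ 1) (y : G) :
    ∫⁻ x, ‖f x‖ₑ * ‖u (x * y)‖ₑ ∂μ ≤ orliczNorm μ Φ f := by
  have h := lintegral_le_orliczNorm (f := f) (Φ := Φ) (μ := μ) (g := fun x => u (x * y))
    (hu.comp_quasiMeasurePreserving (measurePreserving_mul_right μ y).quasiMeasurePreserving)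
    (by rwa [lintegral_mul_right_eq_self (fun x => youngComplement Φ ‖u x‖)])
  simpa only [enorm_mul] using h

/-- The Orlicz norm is an `L¹`-module norm from the left. -/
theorem lintegral_test_conv_le_left {u f g : G → ℂ} (hu : AEStronglyMeasurable u μ)
    (hf : AEStronglyMeasurable f μ) (hg : AEStronglyMeasurable g μ)
    (huΨ : ∫⁻ x, youngComplement Φ ‖u x‖ ∂μ ≤ 1) :
    ∫⁻ x, ‖u x‖ₑ * ∫⁻ y, ‖f y‖ₑ * ‖g (y⁻¹ * x)‖ₑ ∂μ ∂μ ≤ (∫⁻ x, ‖f x‖ₑ ∂μ) * orliczNorm μ Φ g := by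
  rw [lintegral_conv_swap hu.enorm hf.enorm hg.enorm, ← lintegral_mul_const'' _ hf.enorm]
  refine lintegral_mono fun y => ?_
  gcongr
  rw [← lintegral_mul_left_eq_self _ y]
  simp only [inv_mul_cancel_left, mul_comm ‖u _‖ₑ]
  exact lintegral_mul_enorm_mul_left_le g hu huΨ y

/-- The Orlicz norm is an `L¹`-module norm from the right. -/
theorem lintegral_test_conv_le_right {u f g : G → ℂ} (hu : AEStronglyMeasurable u μ)
    (hf : AEStronglyMeasurable f μ) (hg : AEStronglyMeasurable g μ)
    (huΨ : ∫⁻ x, youngComplement Φ ‖u x‖ ∂μ ≤ 1) :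
    ∫⁻ x, ‖u x‖ₑ * ∫⁻ y, ‖f y‖ₑ * ‖g (y⁻¹ * x)‖ₑ ∂μ ∂μ ≤ orliczNorm μ Φ f * ∫⁻ x, ‖g x‖ₑ ∂μ := by
  -- Writing `y * x` as `(x⁻¹ * y⁻¹)⁻¹` and inverting `y` restores the convolution shape, so the
  -- same Tonelli swap can bring `g` outside.
  have hinv := (Measure.measurePreserving_inv μ).quasiMeasurePreserving
  calc ∫⁻ x, ‖u x‖ₑ * ∫⁻ y, ‖f y‖ₑ * ‖g (y⁻¹ * x)‖ₑ ∂μ ∂μ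
      = ∫⁻ y, ‖f y‖ₑ * ∫⁻ x, ‖g x‖ₑ * ‖u (x⁻¹ * y⁻¹)⁻¹‖ₑ ∂μ ∂μ := by
        rw [lintegral_conv_swap hu.enorm hf.enorm hg.enorm]
        refine lintegral_congr fun y => ?_
        rw [← lintegral_mul_left_eq_self _ y]
        simp only [inv_mul_cancel_left, mul_comm ‖u _‖ₑ, mul_inv_rev, inv_inv]
    _ = ∫⁻ y, ‖f y⁻¹‖ₑ * ∫⁻ x, ‖g x‖ₑ * ‖u (x⁻¹ * y)⁻¹‖ₑ ∂μ ∂μ := by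
        rw [← lintegral_inv_eq_self (μ := μ) (fun y => ‖f y‖ₑ * _)]
        simp only [inv_inv]
    _ = ∫⁻ x, ‖g x‖ₑ * ∫⁻ y, ‖f y⁻¹‖ₑ * ‖u (x⁻¹ * y)⁻¹‖ₑ ∂μ ∂μ :=
        lintegral_conv_swap (u := fun y => ‖f y⁻¹‖ₑ) (g := fun y => ‖u y⁻¹‖ₑ)
          (hf.comp_quasiMeasurePreserving hinv).enorm hg.enorm
          (hu.comp_quasiMeasurePreserving hinv).enorm
    _ = ∫⁻ x, ‖g x‖ₑ * ∫⁻ y, ‖f y‖ₑ * ‖u (y * x)‖ₑ ∂μ ∂μ := by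
        refine lintegral_congr fun x => ?_
        congr 1
        rw [← lintegral_inv_eq_self (μ := μ) (fun y => ‖f y‖ₑ * _)]
        simp only [mul_inv_rev, inv_inv]
    _ ≤ ∫⁻ x, ‖g x‖ₑ * orliczNorm μ Φ f ∂μ :=
        lintegral_mono fun x => mul_le_mul_right (lintegral_mul_enorm_mul_right_le f hu huΨ x) _
    _ = orliczNorm μ Φ f * ∫⁻ x, ‖g x‖ₑ ∂μ := by
        rw [lintegral_mul_const'' _ hg.enorm, mul_comm]

/-- For a sub-additive weight, the weighted Orlicz norm is a differential norm with respect to the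
`L¹`-norm. -/
theorem weightedOrliczNorm_groupConv_le (hvm : Measurable v) (hv0 : ∀ x, 0 ≤ v x)
    (hv : ∀ x y, v (x * y) ≤ v x + v y) {f g : G → ℂ} (hf : AEStronglyMeasurable f μ)
    (hg : AEStronglyMeasurable g μ) :
    weightedOrliczNorm μ Φ v (groupConv μ f g) ≤
      weightedOrliczNorm μ Φ v f * (∫⁻ x, ‖g x‖ₑ ∂μ) +
        (∫⁻ x, ‖f x‖ₑ ∂μ) * weightedOrliczNorm μ Φ v g := by
  refine iSup_le fun u => iSup_le fun hu => iSup_le fun huΨ => ?_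
  have hvc : AEStronglyMeasurable (fun x => (v x : ℂ)) μ :=
    (Complex.measurable_ofReal.comp hvm).aestronglyMeasurable
  -- Sub-additivity for the factorisation `x = y * (y⁻¹ * x)` splits the weight between the two
  -- convolution factors.
  have hvle : ∀ x y, ‖(v x : ℂ)‖ₑ ≤ ‖(v y : ℂ)‖ₑ + ‖(v (y⁻¹ * x) : ℂ)‖ₑ := by
    intro x y
    have h := hv y (y⁻¹ * x)
    rw [mul_inv_cancel_left] at h
    simp only [← ofReal_norm, Complex.norm_real, Real.norm_of_nonneg (hv0 _)]
    rw [← ENNReal.ofReal_add (hv0 _) (hv0 _)]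
    exact ENNReal.ofReal_le_ofReal h
  have hfv : AEStronglyMeasurable (fun x => f x * (v x : ℂ)) μ := hf.mul hvc
  have hgv : AEStronglyMeasurable (fun x => g x * (v x : ℂ)) μ := hg.mul hvc
  have h1 := lintegral_test_conv_le_right hu hfv hg huΨ
  have h2 := lintegral_test_conv_le_left hu hf hgv huΨ
  have hm : AEMeasurable
      (fun x => ‖u x‖ₑ * ∫⁻ y, ‖f y * (v y : ℂ)‖ₑ * ‖g (y⁻¹ * x)‖ₑ ∂μ) μ :=
    hu.enorm.mul (aemeasurable_lintegral_conv hfv.enorm hg.enorm)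
  refine le_trans ?_ (add_le_add h1 h2)
  rw [← lintegral_add_left' hm]
  refine lintegral_mono fun x => ?_
  have hmx : AEMeasurable (fun y => ‖f y * (v y : ℂ)‖ₑ * ‖g (y⁻¹ * x)‖ₑ) μ :=
    hfv.enorm.mul (hg.comp_quasiMeasurePreserving
      (measurePreserving_inv_mul x).quasiMeasurePreserving).enorm
  rw [← mul_add, enorm_mul, mul_comm, ← lintegral_add_left' hmx, enorm_mul]
  gcongr
  calc ‖groupConv μ f g x‖ₑ * ‖(v x : ℂ)‖ₑ
      ≤ (∫⁻ y, ‖f y‖ₑ * ‖g (y⁻¹ * x)‖ₑ ∂μ) * ‖(v x : ℂ)‖ₑ := by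
        gcongr; exact enorm_groupConv_le f g x
    _ = ∫⁻ y, ‖f y‖ₑ * ‖g (y⁻¹ * x)‖ₑ * ‖(v x : ℂ)‖ₑ ∂μ :=
        (lintegral_mul_const' _ _ enorm_ne_top).symm
    _ ≤ _ := by
        refine lintegral_mono fun y => ?_
        simp only [enorm_mul]
        calc _ ≤ ‖f y‖ₑ * ‖g (y⁻¹ * x)‖ₑ * (‖(v y : ℂ)‖ₑ + ‖(v (y⁻¹ * x) : ℂ)‖ₑ) := by
              gcongr; exact hvle x y
          _ = _ := by ring

end Module

theorem convSpectralRadius_anti {G : Type*} [MeasurableSpace G] [Group G] (μ : Measure G)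
    {A B : Set (G → ℂ)} (h : A ⊆ B) (f : G → ℂ) :
    convSpectralRadius μ B f ≤ convSpectralRadius μ A f := by
  refine biSup_mono fun z hz => hz.imp_right fun hz' => ?_
  rintro ⟨g, hg, hg'⟩
  exact hz' ⟨g, h hg, hg'⟩

/-- If `k` is in the spectrum of `c⁻¹ • f`, then `c * k` is in that of `f`. This reduces an
arbitrary spectral parameter to the parameter 1. -/
theorem convSpectralRadius_inv_smul_le {G : Type*} [MeasurableSpace G] [Group G] (μ : Measure G)
    (A : Set (G → ℂ)) (f : G → ℂ) (c : ℂ) :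
    ‖c‖ₑ * convSpectralRadius μ A (c⁻¹ • f) ≤ convSpectralRadius μ A f := by
  simp only [convSpectralRadius, ENNReal.mul_iSup]
  refine iSup₂_le fun k hk => ?_
  rw [← enorm_mul]
  refine le_iSup₂_of_le (f := fun z (_ : z ∈ convSpectrum μ A f) => ‖z‖ₑ) (c * k) ?_ le_rfl
  refine hk.imp (fun h => by rw [h, mul_zero]) fun h => ?_
  rwa [mul_inv_rev, mul_smul]

theorem weightedOrliczNorm_smul_le {G : Type*} [MeasurableSpace G] (μ : Measure G)
    (Φ : ℝ → ℝ≥0∞) (v : G → ℝ) (c : ℂ) (f : G → ℂ) :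
    weightedOrliczNorm μ Φ v (c • f) ≤ ‖c‖ₑ * weightedOrliczNorm μ Φ v f := by
  refine iSup_le fun u => iSup_le fun hu => iSup_le fun huΨ => ?_
  refine le_trans ?_ (mul_le_mul_right (lintegral_le_orliczNorm hu huΨ) _)
  rw [← lintegral_const_mul' _ _ enorm_ne_top]
  refine (lintegral_congr fun x => ?_).le
  simp only [Pi.smul_apply, smul_eq_mul, enorm_mul, mul_assoc]

theorem enorm_coeFn_eq {G : Type*} [MeasurableSpace G] {μ : Measure G} (f : G →₁[μ] ℂ) :
    ∫⁻ x, ‖f x‖ₑ ∂μ = ‖f‖ₑ := by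
  rw [← L1.ofReal_norm_eq_lintegral, ofReal_norm]

/-! ### Neumann series and comparison of spectral radii. -/

section Spectrum

variable {G : Type*} [Group G] [TopologicalSpace G] [IsTopologicalGroup G] [LocallyCompactSpace G]
  [T2Space G] [SigmaCompactSpace G] [MeasurableSpace G] [BorelSpace G]
  {μ : Measure G} [μ.IsHaarMeasure] [μ.Regular] [μ.IsMulRightInvariant] [μ.IsInvInvariant]
  {Φ : ℝ → ℝ≥0∞} {v ω : G → ℝ}

theorem l1Conv_l1Conv (f g : G →₁[μ] ℂ) : l1Conv μ (l1Conv μ f g) = l1Conv μ f * l1Conv μ g :=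
  ContinuousLinearMap.ext fun k => l1Conv_assoc f g k

/-- The vector `(l1Conv μ f ^ n) f` is the `(n + 1)`-fold convolution power of `f`; the shift avoids
an identity element, which `L¹` may lack. -/
theorem l1Conv_pow_apply (f : G →₁[μ] ℂ) (n : ℕ) :
    l1Conv μ ((l1Conv μ f ^ n) f) = l1Conv μ f ^ (n + 1) := by
  induction n with
  | zero => simp
  | succ n ih => rw [pow_succ' _ n, mul_apply_eq_comp, l1Conv_l1Conv, ih, ← pow_succ']

theorem l1Conv_pow_pow (f : G →₁[μ] ℂ) (n m : ℕ) :
    l1Conv μ ((l1Conv μ f ^ n) f) ((l1Conv μ f ^ m) f) = (l1Conv μ f ^ (n + m + 1)) f := by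
  rw [l1Conv_pow_apply, ← mul_apply_eq_comp, ← pow_add]
  congr 2
  ring

/-- A quasi-inverse of `f` makes `1 - l1Conv f` invertible. -/
theorem isUnit_one_sub_l1Conv {f g : G →₁[μ] ℂ} (h1 : f + g = l1Conv μ f g)
    (h2 : f + g = l1Conv μ g f) : IsUnit (1 - l1Conv μ f) := by
  have e1 : l1Conv μ f + l1Conv μ g = l1Conv μ f * l1Conv μ g := by
    rw [← map_add, h1, l1Conv_l1Conv]
  have e2 : l1Conv μ f + l1Conv μ g = l1Conv μ g * l1Conv μ f := by
    rw [← map_add, h2, l1Conv_l1Conv]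
  refine ⟨⟨1 - l1Conv μ f, 1 - l1Conv μ g, ?_, ?_⟩, rfl⟩
  · rw [sub_mul, one_mul, mul_sub, mul_one, ← e1]; abel
  · rw [sub_mul, one_mul, mul_sub, mul_one, ← e2]; abel

/-- The spectral radius of the left convolution operator is at most that in the convolution
algebra. -/
theorem spectralRadius_l1Conv_le {f : G → ℂ} (hf : Integrable f μ) :
    spectralRadius ℂ (l1Conv μ (hf.toL1 f)) ≤ convSpectralRadius μ (lOneSpace μ) f := by
  refine iSup₂_le fun k hk => ?_
  refine le_iSup₂_of_le (f := fun z (_ : z ∈ convSpectrum μ (lOneSpace μ) f) => ‖z‖ₑ) k ?_ le_rfl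
  by_contra hk'
  simp only [convSpectrum, mem_ofPred_eq, not_or, not_not] at hk'
  obtain ⟨hk0, g, hg, e1, e2⟩ := hk'
  have hg : Integrable g μ := hg
  have hkf : Integrable (k⁻¹ • f) μ := hf.smul k⁻¹
  have hu : IsUnit (1 - l1Conv μ (hkf.toL1 _)) := by
    refine isUnit_one_sub_l1Conv (g := hg.toL1 g) ?_ ?_
    · rw [l1Conv_toL1, ← Integrable.toL1_add, Integrable.toL1_eq_toL1_iff]
      exact e1
    · rw [l1Conv_toL1, ← Integrable.toL1_add, Integrable.toL1_eq_toL1_iff]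
      exact e2
  refine hk ?_
  have : algebraMap ℂ _ k - l1Conv μ (hf.toL1 f) = k • (1 - l1Conv μ (hkf.toL1 _)) := by
    rw [Integrable.toL1_smul' f hf, map_smul, smul_sub, smul_inv_smul₀ hk0,
      Algebra.algebraMap_eq_smul_one]
  rw [spectrum.mem_resolventSet_iff, this]
  exact (Units.mk0 k hk0 • hu.unit).isUnit

theorem enorm_l1Conv_le (f g : G →₁[μ] ℂ) : ‖l1Conv μ f g‖ₑ ≤ ‖f‖ₑ * ‖g‖ₑ := by
  rw [← enorm_coeFn_eq, ← enorm_coeFn_eq, ← enorm_coeFn_eq,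
    lintegral_congr_ae ((coeFn_l1Conv f g).mono fun x hx => by rw [hx])]
  exact lintegral_enorm_groupConv_le (Lp.aestronglyMeasurable f) (Lp.aestronglyMeasurable g)

theorem weightedOrliczNorm_l1Conv_le (hvm : Measurable v) (hv0 : ∀ x, 0 ≤ v x)
    (hv : ∀ x y, v (x * y) ≤ v x + v y) (f g : G →₁[μ] ℂ) :
    weightedOrliczNorm μ Φ v (l1Conv μ f g) ≤
      weightedOrliczNorm μ Φ v f * ‖g‖ₑ + ‖f‖ₑ * weightedOrliczNorm μ Φ v g := by
  rw [weightedOrliczNorm_congr (coeFn_l1Conv f g), ← enorm_coeFn_eq, ← enorm_coeFn_eq]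
  exact weightedOrliczNorm_groupConv_le hvm hv0 hv (Lp.aestronglyMeasurable f)
    (Lp.aestronglyMeasurable g)

/-- If `f` has finite weighted norm for a sub-additive weight and its convolution operator on `L¹`
has spectral radius less than one, then the Neumann series of `f` converges absolutely, both in
`L¹` and in the weighted norm. -/
theorem tsum_pow_ne_top (hvm : Measurable v) (hv0 : ∀ x, 0 ≤ v x)
    (hv : ∀ x y, v (x * y) ≤ v x + v y) {f : G →₁[μ] ℂ} (hfin : weightedOrliczNorm μ Φ v f ≠ ∞)
    (hrad : spectralRadius ℂ (l1Conv μ f) < 1) :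
    ∑' n, ‖(l1Conv μ f ^ n) f‖ₑ ≠ ∞ ∧
      ∑' n, weightedOrliczNorm μ Φ v ((l1Conv μ f ^ n) f : G →₁[μ] ℂ) ≠ ∞ := by
  set p : ℕ → G →₁[μ] ℂ := fun n => (l1Conv μ f ^ n) f with hp
  set S : (G →₁[μ] ℂ) → ℝ≥0∞ := fun g => weightedOrliczNorm μ Φ v g with hS
  have hSfin : ∀ n, S (p n) ≠ ∞ := by
    intro n
    induction n with
    | zero => simpa [hp, hS] using hfin
    | succ n ih =>
      have : p (n + 1) = l1Conv μ f (p n) := by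
        simp only [hp, pow_succ', mul_apply_eq_comp]
      rw [this]
      refine ne_top_of_le_ne_top ?_ (weightedOrliczNorm_l1Conv_le hvm hv0 hv f (p n))
      exact ENNReal.add_ne_top.2
        ⟨ENNReal.mul_ne_top hfin enorm_ne_top, ENNReal.mul_ne_top enorm_ne_top ih⟩
  have hlim : Tendsto (fun n => ‖p n‖ₑ) atTop (𝓝 0) := by
    have h1 : Tendsto (fun n => ‖l1Conv μ f ^ n‖ₑ * ‖f‖ₑ) atTop (𝓝 (0 * ‖f‖ₑ)) :=
      ENNReal.Tendsto.mul_const (tendsto_pow_norm_of_spectralRadius_lt_one hrad)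
        (Or.inr enorm_ne_top)
    rw [zero_mul] at h1
    exact tendsto_of_tendsto_of_tendsto_of_le_of_le tendsto_const_nhds h1 (fun _ => zero_le)
      fun n => ContinuousLinearMap.le_opENorm _ _
  obtain ⟨N, hN⟩ := (hlim.eventually_lt_const zero_lt_one).exists
  -- As `‖p N‖₁ < 1` strictly and the weighted norm of `p N` is finite, a small nonzero multiple of
  -- the latter fits in the gap.
  obtain ⟨ε, hε0, hεtop, hε⟩ : ∃ ε : ℝ≥0∞, ε ≠ 0 ∧ ε ≠ ∞ ∧ ‖p N‖ₑ + ε * S (p N) < 1 := by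
    have h1 : Tendsto (fun n : ℕ => ‖p N‖ₑ + ((n : ℝ≥0∞))⁻¹ * S (p N)) atTop
        (𝓝 (‖p N‖ₑ + 0 * S (p N))) :=
      (ENNReal.Tendsto.mul_const ENNReal.tendsto_inv_nat_nhds_zero
        (Or.inr (hSfin N))).const_add _
    rw [zero_mul, add_zero] at h1
    obtain ⟨n, hn, hn0⟩ := ((h1.eventually_lt_const hN).and (eventually_gt_atTop 0)).exists
    exact ⟨(n : ℝ≥0∞)⁻¹, by simp, by simp [hn0.ne'], hn⟩
  have hsum : ∑' n, (‖p n‖ₑ + ε * S (p n)) ≠ ∞ := by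
    refine ENNReal.tsum_ne_top_of_submultiplicative (fun n m => ?_) (fun n => ?_) hε
    · have e : p (n + m + 1) = l1Conv μ (p n) (p m) := (l1Conv_pow_pow f n m).symm
      rw [e]
      have h1 := enorm_l1Conv_le (p n) (p m)
      have h2 := weightedOrliczNorm_l1Conv_le (Φ := Φ) hvm hv0 hv (p n) (p m)
      calc ‖l1Conv μ (p n) (p m)‖ₑ + ε * S (l1Conv μ (p n) (p m))
          ≤ ‖p n‖ₑ * ‖p m‖ₑ + ε * (S (p n) * ‖p m‖ₑ + ‖p n‖ₑ * S (p m)) := by gcongr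
        -- Adding the `ε²` term completes the product of the two combined norms.
        _ ≤ ‖p n‖ₑ * ‖p m‖ₑ + ε * (S (p n) * ‖p m‖ₑ + ‖p n‖ₑ * S (p m))
            + ε * ε * S (p n) * S (p m) := le_self_add
        _ = _ := by ring
    · exact ENNReal.add_ne_top.2 ⟨enorm_ne_top, ENNReal.mul_ne_top hεtop (hSfin n)⟩
  rw [ENNReal.tsum_add, ENNReal.tsum_mul_left, ENNReal.add_ne_top] at hsum
  exact ⟨hsum.1, fun h => hsum.2 (by rw [h, ENNReal.mul_top hε0])⟩

/-- The Neumann series provides a quasi-inverse. -/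
theorem quasiInverse_of_summable {f : G →₁[μ] ℂ}
    (h : Summable fun n : ℕ => (l1Conv μ f ^ n) f) :
    f + -∑' n : ℕ, (l1Conv μ f ^ n) f = l1Conv μ f (-∑' n : ℕ, (l1Conv μ f ^ n) f) ∧
    f + -∑' n : ℕ, (l1Conv μ f ^ n) f = l1Conv μ (-∑' n : ℕ, (l1Conv μ f ^ n) f) f := by
  have h0 : ∑' n : ℕ, (l1Conv μ f ^ n) f = f + ∑' n : ℕ, (l1Conv μ f ^ (n + 1)) f := by
    rw [h.tsum_eq_zero_add]; simp
  have h1 : l1Conv μ f (∑' n : ℕ, (l1Conv μ f ^ n) f) = ∑' n : ℕ, (l1Conv μ f ^ (n + 1)) f := by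
    rw [ContinuousLinearMap.map_tsum _ h]
    simp only [pow_succ', mul_apply_eq_comp]
  have h2 : l1Conv μ (∑' n : ℕ, (l1Conv μ f ^ n) f) f = ∑' n : ℕ, (l1Conv μ f ^ (n + 1)) f := by
    rw [← ContinuousLinearMap.flip_apply, ContinuousLinearMap.map_tsum _ h]
    simp only [ContinuousLinearMap.flip_apply, l1Conv_pow_apply]
  constructor
  · rw [map_neg, h1, h0]; abel
  · rw [map_neg, neg_apply, h2, h0]; abel

/-- The spectral radius in a weighted Orlicz space, for elements of the smaller space given by a
larger sub-additive weight, is at most the one in `L¹`. -/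
theorem convSpectralRadius_weightedOrliczSpace_le (hΦ : IsYoungFunction Φ)
    (hvm : Measurable v) (hv : ∀ x y, v (x * y) ≤ v x + v y) (hω : ∀ x, 1 ≤ ω x)
    (hωv : ∀ x, ω x ≤ v x) {f : G → ℂ} (hf : Integrable f μ)
    (hfv : weightedOrliczNorm μ Φ v f ≠ ∞) :
    convSpectralRadius μ (weightedOrliczSpace μ Φ ω) f ≤
      convSpectralRadius μ (lOneSpace μ) f := by
  have hv0 : ∀ x, 0 ≤ v x := fun x => zero_le_one.trans ((hω x).trans (hωv x))
  refine iSup₂_le fun z hz => ?_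
  by_contra! hlt
  rcases hz with rfl | hz
  · simp at hlt
  have hz0 : z ≠ 0 := by rintro rfl; simp at hlt
  refine hz ?_
  have hzf : Integrable (z⁻¹ • f) μ := hf.smul z⁻¹
  set h : G →₁[μ] ℂ := hzf.toL1 _ with hh
  -- Otherwise `‖z‖ₑ` would be at most the `L¹` spectral radius of `f`, by rescaling.
  have hrad : spectralRadius ℂ (l1Conv μ h) < 1 := by
    refine (spectralRadius_l1Conv_le hzf).trans_lt ?_
    by_contra! h1
    refine absurd (convSpectralRadius_inv_smul_le μ (lOneSpace μ) f z) (not_le_of_gt ?_)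
    exact hlt.trans_le (le_mul_of_one_le_right zero_le h1)
  have hfin : weightedOrliczNorm μ Φ v h ≠ ∞ := by
    rw [weightedOrliczNorm_congr hzf.coeFn_toL1]
    exact ne_top_of_le_ne_top (ENNReal.mul_ne_top enorm_ne_top hfv)
      (weightedOrliczNorm_smul_le μ Φ v z⁻¹ f)
  obtain ⟨hs1, hs2⟩ := tsum_pow_ne_top hvm hv0 hv hfin hrad
  have hsum : Summable fun n : ℕ => (l1Conv μ h ^ n) h := by
    refine Summable.of_norm ?_
    simpa using ENNReal.summable_toReal hs1
  obtain ⟨e1, e2⟩ := quasiInverse_of_summable hsum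
  set q : G →₁[μ] ℂ := -∑' n : ℕ, (l1Conv μ h ^ n) h with hq
  have hqv : weightedOrliczNorm μ Φ ω q < ∞ := by
    refine lt_of_le_of_lt ?_ hs2.lt_top
    refine (weightedOrliczNorm_mono_weight (fun x => zero_le_one.trans (hω x)) hωv _).trans ?_
    refine le_trans ?_ (weightedOrliczNorm_tsum_le hvm hsum)
    refine weightedOrliczNorm_mono_ae ?_
    filter_upwards [Lp.coeFn_neg (∑' n : ℕ, (l1Conv μ h ^ n) h)] with x hx
    rw [hq, hx, Pi.neg_apply, enorm_neg]
  have hadd : z⁻¹ • f + (q : G → ℂ) =ᵐ[μ] (h + q : G →₁[μ] ℂ) :=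
    ((hzf.coeFn_toL1.symm).add (ae_eq_refl _)).trans (Lp.coeFn_add h q).symm
  refine ⟨q, ⟨hΦ.memOrlicz_of_orliczNorm_lt_top (Lp.aestronglyMeasurable q)
    ((orliczNorm_le_weightedOrliczNorm hω _).trans_lt hqv), hqv⟩, ?_, ?_⟩
  · refine hadd.trans ?_
    rw [e1, groupConv_congr hzf.coeFn_toL1.symm (ae_eq_refl _)]
    exact coeFn_l1Conv h q
  · refine hadd.trans ?_
    rw [e2, groupConv_congr (ae_eq_refl _) hzf.coeFn_toL1.symm]
    exact coeFn_l1Conv q h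

end Spectrum

/-! ### The theorem. -/

theorem theorem1 {G : Type*} [Group G] [TopologicalSpace G] [IsTopologicalGroup G]
    [LocallyCompactSpace G] [T2Space G] [MeasurableSpace G] [BorelSpace G]
    (μ : MeasureTheory.Measure G) [μ.IsHaarMeasure] [μ.Regular]
    (_hG : IsLocallyElliptic G)
    (K : ℕ → Subgroup G) (_hK : IsStandardDecomposition K)
    (Φ Ψ : ℝ → ℝ≥0∞) (_hΦΨ : IsComplementaryPair Φ Ψ)
    (ω : G → ℝ) (_hω : IsLPhiWeight μ Φ ω)
    (_hΨ : MemOrlicz μ Ψ (fun x => ((1 / ω x : ℝ) : ℂ))) :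
    IsSubadditiveWeight (sharpOne μ K ω) ∧
    weightedOrliczSpace μ Φ (sharpOne μ K ω) ⊆ weightedOrliczSpace μ Φ ω ∧
    weightedOrliczSpace μ Φ ω ⊆ lOneSpace μ ∧
    ∀ f ∈ weightedOrliczSpace μ Φ (sharpOne μ K ω),
      convSpectralRadius μ (weightedOrliczSpace μ Φ ω) f =
        convSpectralRadius μ (lOneSpace μ) f := by
  have hw : IsWeight ω := _hω.toIsWeight
  have hω0 : ∀ x, 0 ≤ ω x := fun x => zero_le_one.trans (hw.one_le x)
  have hsub := _hK.isSubadditiveWeight_sharpOne (μ := μ) hw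
  have h12 : weightedOrliczSpace μ Φ (sharpOne μ K ω) ⊆ weightedOrliczSpace μ Φ ω := fun f hf =>
    ⟨hf.1, (weightedOrliczNorm_mono_weight hω0 (_hK.le_sharpOne hw) f).trans_lt hf.2⟩
  have h23 : weightedOrliczSpace μ Φ ω ⊆ lOneSpace μ := by
    intro f hf
    refine ⟨hf.1.1, ?_⟩
    -- Hölder pairs `f ω`, of finite Orlicz norm, with `1/ω`, which lies in the complementary space.
    have h := lintegral_mul_lt_top_of_memOrlicz hf.2 (_hΦΨ.eq_complement ▸ _hΨ)
    refine lt_of_eq_of_lt (lintegral_congr fun x => ?_) h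
    have hx : ω x ≠ 0 := (zero_lt_one.trans_le (hw.one_le x)).ne'
    congr 1
    rw [mul_assoc, ← Complex.ofReal_mul, mul_one_div_cancel hx, Complex.ofReal_one, mul_one]
  refine ⟨hsub, h12, h23, fun f hf => ?_⟩
  have : SigmaCompactSpace G := _hK.sigmaCompactSpace
  have : μ.IsMulRightInvariant := isMulRightInvariant_of_compactOpen fun x => by
    obtain ⟨i, hi⟩ := _hK.exists_mem x
    exact ⟨K i, _hK.isCompact i, _hK.isOpen i, hi⟩
  have : μ.IsInvInvariant := isInvInvariant_of_compactOpen (_hK.isCompact 0) (_hK.isOpen 0)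
  refine le_antisymm ?_ (convSpectralRadius_anti μ h23 f)
  refine convSpectralRadius_weightedOrliczSpace_le _hΦΨ.young hsub.measurable (fun x y => ?_)
    hw.one_le (_hK.le_sharpOne hw) (h23 (h12 hf)) hf.2.ne
  refine (_hK.sharpOne_mul_le_max hw x y).trans (max_le ?_ ?_)
  · linarith [hsub.one_le y]
  · linarith [hsub.one_le x]
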